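/- For $n\ge 1$, an $n$-tape automaton over a finite nonempty alphabet $\Sigma$ consists of a finite set $Q$ of states, a map $\tau$ assigning to each state one of the $n$ tapes, a nondeterministic transition function $\delta\colon Q\times(\Sigma\cup\{\$\})\to 2^Q$ with an end-marker $\$\notin\Sigma$, a set of initial states and a set of accepting states. On input $\langle x_1,\dots,x_n\rangle\in(\Sigma^*)^n$, tape $i$ initially contains $x_i\$$. A move in state $q$ reads the next symbol $\sigma$ of tape $\tau(q)$ (it is impossible if that tape has been read completely) and goes to some state in $\delta(q,\sigma)$; the heads on the tapes move independently of each other. The input is accepted if some sequence of moves from an initial state reaches an accepting state, and $\mathcal L(A)$ is the set of accepted $n$-tuples. A subset of $(\Sigma^*)^n$ is rational if it equals $\mathcal L(C)$ for some $n$-tape automaton $C$ over $\Sigma$. The rational intersection problem is: given (the transition tables of) two multi-tape automata $A$ and $B$ with the same tapes and the same alphabet, determine whether $\mathcal L(A)\cap\mathcal L(B)$ is rational. Theorem. The rational intersection problem is not semidecidable: the set of pairs $(A,B)$ for which $\mathcal L(A)\cap\mathcal L(B)$ is rational is not recursively enumerable. This holds when the number of tapes is part of the input, and also, for every fixed $n\ge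 2$, for the problem restricted to $n$-tape automata (with the alphabet part of the input). -/

import Mathlib

/-- A nondeterministic finite automaton reading tapes indexed by `T`, with input alphabet `α` and
states `Q`. The state decides which tape is read. The extended alphabet (with the right
end-marker `$`) is `Option α`, where `none` is `$`. -/
structure MultiTapeAutomaton (T α Q : Type) where
  /-- the tape read in each state -/
  tape : Q → T
  /-- the transition function -/
  step : Q → Option α → Set Q
  /-- the initial states -/
  start : Set Q
  /-- the accepting states -/
  accept : Set Q

namespace MultiTapeAutomaton

variable {T α Q : Type} [DecidableEq T]

/-- A configuration: the current state and, on every tape, the input still to be read. -/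
abbrev Config (T α Q : Type) : Type := Q × (T → List (Option α))

/-- One move: read the next symbol on the tape of the current state, and change state. -/
def Move (A : MultiTapeAutomaton T α Q) (c c' : Config T α Q) : Prop :=
  ∃ (s : Option α) (rest : List (Option α)),
    c.2 (A.tape c.1) = s :: rest ∧
    c'.1 ∈ A.step c.1 s ∧
    c'.2 = Function.update c.2 (A.tape c.1) rest

/-- The initial tape contents `x₁$, …, xₙ$`. -/
def marked (x : T → List α) : T → List (Option α) :=
  fun t => (x t).map some ++ [none]

/-- The accepted language: the tuples of words from which some run reaches an accepting state
(whether or not the tapes have been read to the end). -/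
def language (A : MultiTapeAutomaton T α Q) : Set (T → List α) :=
  {x | ∃ q₀ ∈ A.start, ∃ q ∈ A.accept, ∃ y : T → List (Option α),
    Relation.ReflTransGen A.Move (q₀, marked x) (q, y)}

end MultiTapeAutomaton

/-- A language of tuples of words is rational if some finite multi-tape automaton accepts it. -/
def IsRationalLanguage {T α : Type} [DecidableEq T] (L : Set (T → List α)) : Prop :=
  ∃ (Q : Type) (_ : Finite Q) (A : MultiTapeAutomaton T α Q), A.language = L

/-- A finite description (transition table) of a multi-tape automaton, as input of an algorithm.
States, tapes and letters are numbered from `0`; the end-marker is `none`. -/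
structure AutomatonTable where
  /-- the number of states -/
  states : ℕ
  /-- the list of the tapes read in states `0, 1, …` -/
  tapes : List ℕ
  /-- the initial states -/
  start : List ℕ
  /-- the accepting states -/
  accept : List ℕ
  /-- the transitions `(q, s, q')` -/
  transitions : List (ℕ × Option ℕ × ℕ)

namespace AutomatonTable

/-- Tables as tuples. -/
def equivProd : AutomatonTable ≃
    ℕ × List ℕ × List ℕ × List ℕ × List (ℕ × Option ℕ × ℕ) where
  toFun d := (d.states, d.tapes, d.start, d.accept, d.transitions)
  invFun p := ⟨p.1, p.2.1, p.2.2.1, p.2.2.2.1, p.2.2.2.2⟩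
  left_inv _ := rfl
  right_inv _ := rfl

instance : Primcodable AutomatonTable := Primcodable.ofEquiv _ equivProd

/-- The automaton with the positive number `n + 1` of tapes over the nonempty alphabet of `k + 1`
letters that a table describes. Entries of the table that name no state or letter are ignored,
tape numbers are read modulo `n + 1`, and missing tape numbers are read as `0`; so every table
describes an automaton, and every finite automaton is described by a table up to the names of its
states. -/
def toAutomaton (n k : ℕ) (d : AutomatonTable) :
    MultiTapeAutomaton (Fin (n + 1)) (Fin (k + 1)) (Fin d.states) where
  tape q := Fin.ofNat (n + 1) (d.tapes.getD q 0)
  step q s := {q' | ((q : ℕ), s.map Fin.val, (q' : ℕ)) ∈ d.transitions}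
  start := {q | (q : ℕ) ∈ d.start}
  accept := {q | (q : ℕ) ∈ d.accept}

end AutomatonTable

/-- The intersection of the languages of two automata with `n + 1` tapes over the alphabet of
`k + 1` letters, given by their tables, is rational. -/
def HasRationalIntersection (n k : ℕ) (A B : AutomatonTable) : Prop :=
  IsRationalLanguage ((A.toAutomaton n k).language ∩ (B.toAutomaton n k).language)

/-- The rational intersection problem: an instance `(n, k, A, B)` consists of the tables of two
automata with `n + 1` tapes over the alphabet of `k + 1` letters. -/
def RationalIntersectionProblem (i : ℕ × ℕ × AutomatonTable × AutomatonTable) : Prop :=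
  HasRationalIntersection i.1 i.2.1 i.2.2.1 i.2.2.2

/-- The rational intersection problem for automata with exactly `n + 1` tapes: an instance
`(k, A, B)` consists of the tables of two automata over the alphabet of `k + 1` letters. -/
def RationalIntersectionProblemFor (n : ℕ) (i : ℕ × AutomatonTable × AutomatonTable) : Prop :=
  HasRationalIntersection n i.1 i.2.1 i.2.2

/-! ### Turing machines with unary input -/

open Turing

/-! Some r.e. predicate `p` has a complement that is not r.e. It therefore suffices to map `m`
computably to two automata whose intersection is rational exactly when `p m` fails
(`REPred.exists_reduction`).

Two tapes compared with a shift implement a queue. Let a transducer read its own output from a queue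
that first holds `w`. After it has read `d`, the queue is the word `q` with `d q = w · output d`,
and if the queue never becomes empty this equation characterises the reachable configurations
(`SequentialTransducer.reaches_iff`). One automaton checks that tape `t₀` holds `w` followed by the
content of `t₁`. The other checks that `t₁` holds the output on some prefix `d` of `t₀` leading to a
chosen state. So in the intersection `t₀` holds the words `d q` for the configurations reachable in
that state.

The transducer simulates a queue machine that halts from the queue `w = aᵐe` iff `p m`. After
halting it writes ever longer blocks, each closed by a delimiter, and the chosen state is entered
when a block has been closed. If the machine does not halt, that state is never reached and the
intersection is empty. If it halts, the words on `t₀` are exactly the `growingWord b w' g k` for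
suitable `w'` and `g`. These are not rational (`not_isRationalLanguage_of_forall_ne`): with finitely
many states, two of the prefixes get confused and a block of the wrong length is accepted.

The number `m` enters only through `w`, so only the first automaton varies, and its table is
computable from `m`. -/

theorem trPosNum_of_castNum (m : ℕ) (n : PosNum) (h : (n : ℕ) + 1 = 2 ^ (m + 1)) :
    PartrecToTM2.trPosNum n = List.replicate (m + 1) PartrecToTM2.Γ'.bit1 := by
  induction m generalizing n with
  | zero =>
    cases n with
    | one => rfl
    | bit0 n => simp at h; omega
    | bit1 n => have := n.cast_pos (α := ℕ); simp at h; omega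
  | succ m ih =>
    cases n with
    | one => simp [pow_succ] at h
    | bit0 n => simp [pow_succ] at h; omega
    | bit1 n =>
      rw [PartrecToTM2.trPosNum, ih n, ← List.replicate_succ]
      simp [pow_succ] at h ⊢; omega

/-- In binary these numbers have only digits 1. The initial tape is thus one fixed symbol followed
by a power of another, which is what becomes the queue `aᵐe`. -/
theorem trNat_two_pow_sub_one (m : ℕ) :
    PartrecToTM2.trNat (2 ^ m - 1) = List.replicate m PartrecToTM2.Γ'.bit1 := by
  cases m with
  | zero => simp
  | succ m =>
    have h1 := Nat.one_le_two_pow (n := m)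
    rw [PartrecToTM2.trNat]
    cases h : ((2 ^ (m + 1) - 1 : ℕ) : Num) with
    | zero =>
      have := congrArg (fun a : Num => (a : ℕ)) h
      simp [pow_succ] at this; omega
    | pos n =>
      have := congrArg (fun a : Num => (a : ℕ)) h
      simp at this
      exact trPosNum_of_castNum m n (by rw [← this]; simp [pow_succ]; omega)

theorem REPred.exists_code_dom_two_pow_sub_one {p : ℕ → Prop} (hp : REPred p) :
    ∃ c : ToPartrec.Code, ∀ m, (c.eval [2 ^ m - 1]).Dom ↔ p m := by
  have hg : Partrec fun m : ℕ => (Part.assert (p m) fun _ => Part.some ()).map fun _ => (0 : ℕ) :=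
    Partrec.map hp (Computable.const 0).to₂
  have hpow : Primrec fun j : ℕ => 2 ^ j :=
    (Primrec.nat_rec' Primrec.id (Primrec.const 1)
      ((Primrec.nat_add.comp (Primrec.snd.comp Primrec.snd)
        (Primrec.snd.comp Primrec.snd)).to₂ (α := ℕ) (β := ℕ × ℕ))).of_eq fun j => by
      induction j with
      | zero => rfl
      | succ j ih => simp only [id] at ih; simp [pow_succ, ih]; omega
  -- This search inverts `m ↦ 2 ^ m - 1`: the least `j` with `x + 1 ≤ 2 ^ j` is `m`.
  have hr : Partrec fun x : ℕ => Nat.rfind fun j => Part.some (decide (x + 1 ≤ 2 ^ j)) := by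
    refine Partrec.rfind ?_
    have : PrimrecRel fun x j : ℕ => x + 1 ≤ 2 ^ j :=
      Primrec.nat_le.comp (Primrec.succ.comp Primrec.fst) (hpow.comp Primrec.snd)
    exact (Primrec.to_comp (this.decide)).partrec
  have hF := Partrec.bind hr (hg.comp (Computable.snd (α := ℕ) (β := ℕ))).to₂
  obtain ⟨c, hc⟩ := ToPartrec.Code.exists_code (Nat.Partrec'.part_iff₁.2 hF)
  refine ⟨c, fun m => ?_⟩
  have hc' := hc ⟨[2 ^ m - 1], rfl⟩
  have h1 := Nat.one_le_two_pow (n := m)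
  have hm : (Nat.rfind fun j => Part.some (decide (2 ^ m - 1 + 1 ≤ 2 ^ j))) = Part.some m := by
    refine Part.eq_some_iff.2 (Nat.mem_rfind.2 ?_)
    refine ⟨by simp, fun {j} hj => ?_⟩
    have := Nat.pow_lt_pow_right (a := 2) (by norm_num) hj
    simp; omega
  change c.eval [2 ^ m - 1] = pure <$> (Nat.rfind fun j =>
    Part.some (decide (2 ^ m - 1 + 1 ≤ 2 ^ j))).bind _ at hc'
  rw [hm, Part.bind_some] at hc'
  rw [hc']
  simp [Part.assert]

theorem trInit_main_two_pow_sub_one (m : ℕ) :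
    TM2to1.trInit (K := PartrecToTM2.K') (Γ := fun _ => PartrecToTM2.Γ') PartrecToTM2.K'.main
        (PartrecToTM2.trList [2 ^ m - 1]) =
      (true, Function.update (fun _ => none) PartrecToTM2.K'.main (some PartrecToTM2.Γ'.cons)) ::
      List.replicate m
        (false, Function.update (fun _ => none) PartrecToTM2.K'.main
          (some PartrecToTM2.Γ'.bit1)) := by
  have h : (PartrecToTM2.trList [2 ^ m - 1]).reverse =
      PartrecToTM2.Γ'.cons :: List.replicate m PartrecToTM2.Γ'.bit1 := by
    simp [PartrecToTM2.trList, trNat_two_pow_sub_one]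
  rw [TM2to1.trInit, h]
  exact congrArg (List.cons _) List.map_replicate

instance : Finite PartrecToTM2.K' :=
  Finite.of_injective (β := Fin 4) (fun | .main => 0 | .rev => 1 | .aux => 2 | .stack => 3)
    fun a b h => by cases a <;> cases b <;> first | rfl | cases h

theorem REPred.exists_turingMachine {p : ℕ → Prop} (hp : REPred p) :
    ∃ (Γ Λ : Type) (_ : Inhabited Γ) (_ : Inhabited Λ) (_ : Finite Γ) (M : TM0.Machine Γ Λ)
      (S : Set Λ) (_ : S.Finite) (_ : TM0.Supports M S) (b c : Γ),
      ∀ m, (StateTransition.eval (TM0.step M) (TM0.init (b :: List.replicate m c))).Dom ↔ p m := by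
  obtain ⟨c, hc⟩ := hp.exists_code_dom_two_pow_sub_one
  let _ : Inhabited PartrecToTM2.Λ' := ⟨PartrecToTM2.trNormal c PartrecToTM2.Cont'.halt⟩
  have h2 : ∀ m, (TM2.eval PartrecToTM2.tr PartrecToTM2.K'.main
      (PartrecToTM2.trList [2 ^ m - 1])).Dom ↔ p m := by
    intro m
    rw [← hc]
    have : (TM2.init PartrecToTM2.K'.main (PartrecToTM2.trList [2 ^ m - 1]) :
        TM2.Cfg (fun _ : PartrecToTM2.K' => PartrecToTM2.Γ') PartrecToTM2.Λ'
          (Option PartrecToTM2.Γ')) = PartrecToTM2.init c [2 ^ m - 1] := by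
      simp only [TM2.init, PartrecToTM2.init]
      congr 1
      funext k; cases k <;> rfl
    change (Part.map _ (StateTransition.eval _ (TM2.init _ _))).Dom ↔ _
    rw [this, PartrecToTM2.tr_eval]
    rfl
  have hs := TM1to0.tr_supports _ (TM2to1.tr_supports PartrecToTM2.tr
    (PartrecToTM2.tr_supports c PartrecToTM2.Cont'.halt))
  refine ⟨TM2to1.Γ' PartrecToTM2.K' fun _ => PartrecToTM2.Γ', _, inferInstance, inferInstance,
    (inferInstance : Finite (Bool × ∀ _ : PartrecToTM2.K', Option PartrecToTM2.Γ')), _, _,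
    Finset.finite_toSet _, hs,
    (true, Function.update (fun _ => none) PartrecToTM2.K'.main (some PartrecToTM2.Γ'.cons)),
    (false, Function.update (fun _ => none) PartrecToTM2.K'.main (some PartrecToTM2.Γ'.bit1)),
    fun m => ?_⟩
  refine Iff.trans ?_ ((TM2to1.tr_eval_dom _ _ _).trans (h2 m))
  rw [← TM1to0.tr_eval]
  change _ ↔ (Part.map _ (StateTransition.eval _ _)).Dom
  rw [trInit_main_two_pow_sub_one]
  rfl

/-- The type of states of the compiled machine is infinite, but a finite set supports the machine.
The states are retracted onto that set; the values outside it do not matter. -/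
theorem REPred.exists_finite_turingMachine {p : ℕ → Prop} (hp : REPred p) :
    ∃ (Γ Λ : Type) (_ : Inhabited Γ) (_ : Inhabited Λ) (_ : Finite Γ) (_ : Finite Λ)
      (M : TM0.Machine Γ Λ) (b c : Γ),
      ∀ m, (StateTransition.eval (TM0.step M) (TM0.init (b :: List.replicate m c))).Dom ↔ p m := by
  classical
  obtain ⟨Γ, Λ, _, _, _, M, S, hfin, hS, b, c, h⟩ := hp.exists_turingMachine
  have : Finite S := hfin
  let _ : Inhabited S := ⟨⟨default, hS.1⟩⟩
  let g₁ : PointedMap Λ S :=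
    ⟨fun q => if h : q ∈ S then ⟨q, h⟩ else default, by
      rw [dif_pos hS.1]; rfl⟩
  let i : PointedMap Γ Γ := ⟨id, rfl⟩
  refine ⟨Γ, S, inferInstance, inferInstance, inferInstance, inferInstance,
    M.map i i g₁ Subtype.val, b, c, fun m => ?_⟩
  rw [← h]
  refine StateTransition.tr_eval_dom (TM0.Machine.map_respects M i i g₁ Subtype.val hS
    (fun _ => rfl) fun q hq => ?_) ⟨hS.1, ?_⟩
  · change (dite _ _ _ : S).val = q
    rw [dif_pos hq]
  · rw [TM0.map_init]
    exact congrArg _ (List.map_id _)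

/-! ### Simulation of Turing machines by queue machines -/

open Turing

/-- A deterministic machine whose memory is a queue: in a state, it removes the first letter of the
queue, changes state and appends a word to the queue, unless it halts. -/
def QueueMachine (S α : Type) : Type := S → α → Option (S × List α)

namespace QueueMachine

variable {S α : Type}

/-- One step of a queue machine on a state and a queue. -/
def step (M : QueueMachine S α) : S × List α → Option (S × List α)
  | (_, []) => none
  | (s, a :: u) => (M s a).map fun p => (p.1, u ++ p.2)

theorem step_cons (M : QueueMachine S α) {s s' : S} {a : α} {o : List α} (u : List α)
    (h : M s a = some (s', o)) : (s', u ++ o) ∈ M.step (s, a :: u) := by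
  simp [step, h]

/-- A run from a state and a queue halts while the queue is nonempty. -/
def Halts (M : QueueMachine S α) (c : S × List α) : Prop :=
  ∃ c', StateTransition.Reaches M.step c c' ∧ c'.2 ≠ [] ∧ M.step c' = none

end QueueMachine

namespace Turing.TM0

/-- The letters used by a queue machine that simulates a Turing machine. -/
inductive QueueLetter (Γ : Type)
  | sym : Γ → QueueLetter Γ
  | sep : QueueLetter Γ
  | mark : QueueLetter Γ

/-- The states of a queue machine that simulates a Turing machine. In `scan q a`, the queue holds
the tape to the right of the head, a separator and the tape to the left of the head. In the other
states, the queue is rotated, with a delay of one letter, until the mark is found. -/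
inductive QueueState (Γ Λ : Type)
  | scan : Λ → Γ → QueueState Γ Λ
  | rotate : Λ → Γ → QueueLetter Γ → QueueState Γ Λ
  | rotateBack : Λ → QueueLetter Γ → QueueState Γ Λ

open QueueLetter QueueState

instance {Γ : Type} [Finite Γ] : Finite (QueueLetter Γ) :=
  Finite.of_injective (β := Option (Option Γ))
    (fun | sym a => some (some a) | sep => some none | mark => none)
    fun a b h => by cases a <;> cases b <;> simp_all

instance {Γ Λ : Type} [Finite Γ] [Finite Λ] : Finite (QueueState Γ Λ) :=
  Finite.of_injective (β := (Λ × Γ) ⊕ (Λ × Γ × QueueLetter Γ) ⊕ (Λ × QueueLetter Γ))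
    (fun
      | scan q a => .inl (q, a)
      | rotate q a l => .inr (.inl (q, a, l))
      | rotateBack q l => .inr (.inr (q, l)))
    fun a b h => by cases a <;> cases b <;> simp_all

variable {Γ Λ : Type} [Inhabited Γ] [Inhabited Λ]

/-- The queue machine that simulates a Turing machine. -/
def toQueueMachine (M : Machine Γ Λ) : QueueMachine (QueueState Γ Λ) (QueueLetter Γ)
  | scan q a, y =>
    match M q a with
    | none => none
    | some (q', .write b) => some (rotate q' b y, [mark])
    | some (q', .move .left) => some (rotateBack q' y, [mark, sym a])
    | some (q', .move .right) =>
      match y with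
      | sym c => some (scan q' c, [sym a])
      | _ => some (rotate q' default sep, [sym a, mark])
  | rotate q b l, mark => some (scan q b, [l])
  | rotate q b l, y => some (rotate q b y, [l])
  | rotateBack q (sym c), mark => some (scan q c, [])
  | rotateBack q _, mark => some (scan q default, [sep])
  | rotateBack q l, y => some (rotateBack q y, [l])

theorem toQueueMachine_length_le (M : Machine Γ Λ) {s s' : QueueState Γ Λ} {a : QueueLetter Γ}
    {o : List (QueueLetter Γ)} (h : toQueueMachine M s a = some (s', o)) : o.length ≤ 2 := by
  unfold toQueueMachine at h
  split at h <;> (try split at h) <;> (try split at h) <;> simp_all <;> (obtain ⟨-, rfl⟩ := h) <;>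
    simp

/-- The delay by one letter puts the letter removed by `scan` back in front of the rest, and the
mark disappears. -/
theorem reaches_rotate (M : Machine Γ Λ) (q : Λ) (b : Γ) (z : List (QueueLetter Γ))
    (hz : mark ∉ z) (l : QueueLetter Γ) (r : List (QueueLetter Γ)) :
    StateTransition.Reaches (toQueueMachine M).step (rotate q b l, z ++ mark :: r)
      (scan q b, r ++ l :: z) := by
  induction z generalizing l r with
  | nil => exact .single (QueueMachine.step_cons _ _ rfl)
  | cons y z ih =>
    have hy : toQueueMachine M (rotate q b l) y = some (rotate q b y, [l]) := by
      cases y <;> first | rfl | simp at hz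
    have h := ih (fun h => hz (.tail _ h)) y (r ++ [l])
    refine .head (QueueMachine.step_cons _ (z ++ mark :: r) hy) ?_
    rw [List.append_assoc, List.singleton_append] at h
    rwa [List.append_assoc, List.cons_append]

/-- Only the front of a queue is accessible, so a full rotation is needed to find its last letter:
the letter held when the mark arrives. It is the symbol left of the head, or the separator if the
left list is empty. -/
theorem reaches_rotateBack (M : Machine Γ Λ) (q : Λ) (z z' : List (QueueLetter Γ))
    (hz : mark ∉ z) (l e : QueueLetter Γ) (he : l :: z = z' ++ [e]) (r : List (QueueLetter Γ)) :
    StateTransition.Reaches (toQueueMachine M).step (rotateBack q l, z ++ mark :: r)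
      (rotateBack q e, mark :: (r ++ z')) := by
  induction z generalizing l r z' with
  | nil =>
    cases z' with
    | nil => 
      simp only [List.nil_append, List.cons.injEq, and_true] at he
      rw [he, List.append_nil]
      exact .refl
    | cons => simp at he
  | cons y z ih =>
    cases z' with
    | nil => simp at he
    | cons x z' =>
      simp only [List.cons_append, List.cons.injEq] at he
      obtain ⟨rfl, he⟩ := he
      have hy : toQueueMachine M (rotateBack q l) y = some (rotateBack q y, [l]) := by
        cases y <;> first | rfl | (cases l <;> rfl) | simp at hz
      have h := ih z' (fun h => hz (.tail _ h)) y he (r ++ [l])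
      refine .head (QueueMachine.step_cons _ (z ++ mark :: r) hy) ?_
      rw [List.append_assoc, List.singleton_append] at h
      rwa [List.append_assoc, List.cons_append]

/-- The queue that holds the parts of a tape right and left of the head. -/
def queue (L R : List Γ) : List (QueueLetter Γ) := R.map sym ++ sep :: L.reverse.map sym

/-- The configurations of the queue machine that represent a configuration of the Turing
machine. -/
def QueueRel (c : Cfg Γ Λ) (d : QueueState Γ Λ × List (QueueLetter Γ)) : Prop :=
  ∃ L R, c.Tape.left = ListBlank.mk L ∧ c.Tape.right = ListBlank.mk R ∧
    d = (scan c.q c.Tape.head, queue L R)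

theorem toQueueMachine_respects (M : Machine Γ Λ) :
    StateTransition.Respects (step M) (toQueueMachine M).step QueueRel := by
  rintro ⟨q, ⟨a, TL, TR⟩⟩ _ ⟨L, R, hL, hR, rfl⟩
  simp only at hL hR
  subst hL hR
  have hmark : ∀ L R : List Γ, mark ∉ queue L R := by simp [queue]
  obtain ⟨y, z, hyz⟩ : ∃ y z, queue L R = y :: z := by
    cases R <;> simp [queue]
  have hz : mark ∉ z := fun h => hmark L R (hyz ▸ .tail _ h)
  simp only [step]
  rcases hM : M q a with _ | ⟨q', (_ | _) | b⟩
  · simp [hyz, QueueMachine.step, toQueueMachine, hM]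
  · refine ⟨(scan q' L.headI, queue L.tail (a :: R)),
      ⟨L.tail, a :: R, by simp [Tape.move], by simp [Tape.move], by simp [Tape.move]⟩, ?_⟩
    · have h1 : toQueueMachine M (scan q a) y = some (rotateBack q' y, [mark, sym a]) := by
        simp [toQueueMachine, hM]
      rw [hyz]
      refine .head' (QueueMachine.step_cons _ _ h1) ?_
      obtain ⟨e, z', hz'⟩ : ∃ e z', y :: z = z' ++ [e] :=
        ⟨_, _, (List.dropLast_append_getLast (l := y :: z) (by simp)).symm⟩
      have h2 := reaches_rotateBack M q' z z' hz y e hz' [sym a]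
      refine h2.trans ?_
      refine .single (b := (scan q' L.headI, queue L.tail (a :: R))) ?_
      rw [← hyz, queue] at hz'
      cases L with
      | nil =>
        have : R.map sym = z' ∧ sep = e := by simpa using hz'
        obtain ⟨rfl, rfl⟩ := this
        have h3 : toQueueMachine M (rotateBack q' sep) mark = some (scan q' default, [sep]) := rfl
        simpa [queue] using QueueMachine.step_cons _ ([sym a] ++ R.map sym) h3
      | cons l L =>
        have := List.append_inj' (s₁ := R.map sym ++ sep :: L.reverse.map sym) (t₁ := [sym l])
          (s₂ := z') (t₂ := [e]) (by rw [← hz']; simp) rfl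
        simp only [List.cons.injEq, and_true] at this
        obtain ⟨rfl, rfl⟩ := this
        have h3 : toQueueMachine M (rotateBack q' (sym l)) mark = some (scan q' l, []) := rfl
        simpa [queue] using
          QueueMachine.step_cons _ ([sym a] ++ (R.map sym ++ sep :: L.reverse.map sym)) h3
  · refine ⟨(scan q' R.headI, queue (a :: L) R.tail),
      ⟨a :: L, R.tail, by simp [Tape.move], by simp [Tape.move], by simp [Tape.move]⟩, ?_⟩
    cases R with
    | nil =>
      -- With no symbol to the right, the letter removed is the separator. The head scans a blank,
      -- and a rotation brings the separator back to the front.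
      have h1 : toQueueMachine M (scan q a) sep =
          some (rotate q' default sep, [sym a, mark]) := by
        simp [toQueueMachine, hM]
      refine .head' (QueueMachine.step_cons _ _ h1) ?_
      have h2 := reaches_rotate M q' default (L.reverse.map sym ++ [sym a]) (by simp) sep []
      simp only [queue, List.append_assoc, List.singleton_append, List.nil_append, List.map_nil,
        List.tail_nil, List.reverse_cons, List.map_append, List.map_cons] at h2 ⊢
      exact h2
    | cons c R =>
      have h1 : toQueueMachine M (scan q a) (sym c) = some (scan q' c, [sym a]) := by
        simp [toQueueMachine, hM]
      refine .single ?_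
      simpa [queue] using QueueMachine.step_cons _ (queue L R) h1
  · refine ⟨(scan q' b, queue L R), ⟨L, R, rfl, rfl, rfl⟩, ?_⟩
    have h1 : toQueueMachine M (scan q a) y = some (rotate q' b y, [mark]) := by
      simp [toQueueMachine, hM]
    rw [hyz]
    refine .head' (QueueMachine.step_cons _ _ h1) ?_
    exact reaches_rotate M q' b z hz y []

theorem toQueueMachine_halts_iff (M : Machine Γ Λ) (b : Γ) (l : List Γ) :
    (toQueueMachine M).Halts (scan default b, l.map sym ++ [sep]) ↔
      (StateTransition.eval (step M) (init (b :: l))).Dom := by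
  have hinit : QueueRel (init (Λ := Λ) (b :: l)) (scan default b, l.map sym ++ [sep]) :=
    ⟨[], l, rfl, rfl, rfl⟩
  constructor
  · rintro ⟨c, hc, -, hn⟩
    rw [← StateTransition.tr_eval_dom (toQueueMachine_respects M) hinit]
    exact Part.dom_iff_mem.2 ⟨c, StateTransition.mem_eval.2 ⟨hc, hn⟩⟩
  · intro h
    obtain ⟨c, ⟨L, R, -, -, rfl⟩, hc⟩ :=
      StateTransition.tr_eval (toQueueMachine_respects M) hinit (Part.get_mem h)
    rw [StateTransition.mem_eval] at hc
    exact ⟨_, hc.1, by simp [queue], hc.2⟩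

end Turing.TM0

namespace QueueMachine

variable {S α : Type}

/-- No run from a state and a queue empties the queue. -/
def NeverEmpty (M : QueueMachine S α) (c : S × List α) : Prop :=
  ∀ c', StateTransition.Reaches M.step c c' → c'.2 ≠ []

end QueueMachine

namespace Turing.TM0

open QueueLetter QueueState

variable {Γ Λ : Type} [Inhabited Γ] [Inhabited Λ]

/-- The separator is in the queue or held in the state, and in a rotation the mark is in the
queue. -/
def SepInvariant : QueueState Γ Λ × List (QueueLetter Γ) → Prop
  | (scan _ _, u) => sep ∈ u
  | (rotate _ _ l, u) => mark ∈ u ∧ (l = sep ∨ sep ∈ u)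
  | (rotateBack _ l, u) => mark ∈ u ∧ (l = sep ∨ sep ∈ u)

theorem SepInvariant.step {M : Machine Γ Λ} {c c' : QueueState Γ Λ × List (QueueLetter Γ)}
    (h : SepInvariant c) (hc : c' ∈ (toQueueMachine M).step c) : SepInvariant c' := by
  obtain ⟨s, _ | ⟨y, u⟩⟩ := c
  · simp [QueueMachine.step] at hc
  · simp only [QueueMachine.step, Option.mem_def, Option.map_eq_some_iff] at hc
    obtain ⟨⟨s', o⟩, hM, rfl⟩ := hc
    unfold toQueueMachine at hM
    split at hM <;> (try split at hM) <;> (try split at hM) <;>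
      simp_all only [reduceCtorEq, Option.some.injEq, Prod.mk.injEq] <;>
      (obtain ⟨rfl, rfl⟩ := hM) <;> simp_all [SepInvariant] <;> grind

/-- Needed for the hypothesis of `SequentialTransducer.reaches_iff`. The separator keeps the queue
nonempty while scanning, the mark during a rotation. -/
theorem toQueueMachine_neverEmpty (M : Machine Γ Λ) (q : Λ) (b : Γ) (u : List (QueueLetter Γ)) :
    (toQueueMachine M).NeverEmpty (scan q b, u ++ [sep]) := by
  intro c' hc
  have : SepInvariant c' := by
    induction hc with
    | refl => simp [SepInvariant]
    | tail _ h ih => exact ih.step h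
  obtain ⟨s, u⟩ := c'
  rintro rfl
  cases s <;> simp [SepInvariant] at this

end Turing.TM0

/-- The bound 2 on the words written leaves finitely many pending outputs, hence finitely many
states in the automaton that checks the output. -/
theorem REPred.exists_queueMachine {p : ℕ → Prop} (hp : REPred p) :
    ∃ (S α : Type) (_ : Finite S) (_ : Finite α) (M : QueueMachine S α) (s : S) (a e : α),
      (∀ {s s' : S} {a : α} {o : List α}, M s a = some (s', o) → o.length ≤ 2) ∧
      (∀ m, M.NeverEmpty (s, List.replicate m a ++ [e])) ∧
      ∀ m, M.Halts (s, List.replicate m a ++ [e]) ↔ p m := by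
  obtain ⟨Γ, Λ, _, _, _, _, M, b, c, h⟩ := hp.exists_finite_turingMachine
  refine ⟨_, _, inferInstance, inferInstance, Turing.TM0.toQueueMachine M, .scan default b, .sym c,
    .sep, fun h => Turing.TM0.toQueueMachine_length_le M h,
    fun m => Turing.TM0.toQueueMachine_neverEmpty _ _ _ _, fun m => ?_⟩
  rw [← h, ← Turing.TM0.toQueueMachine_halts_iff, List.map_replicate]

/-! ### Transducers that read their own output -/

open StateTransition

/-- A sequential transducer: in a state, it reads a letter, changes state and writes a word. -/
structure SequentialTransducer (S α : Type) where
  /-- the next state -/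
  next : S → α → S
  /-- the word written -/
  out : S → α → List α

namespace SequentialTransducer

variable {S α : Type} (N : SequentialTransducer S α)

/-- The state after reading a word. -/
def run (s : S) (d : List α) : S := d.foldl N.next s

/-- The word written while reading a word. -/
def output : S → List α → List α
  | _, [] => []
  | s, a :: d => N.out s a ++ output (N.next s a) d

/-- One step of a transducer that reads its own output from a queue. A configuration is a state, the
word read so far and the queue. -/
def feedback : S × List α × List α → Option (S × List α × List α)
  | (_, _, []) => none
  | (s, d, a :: u) => some (N.next s a, d ++ [a], u ++ N.out s a)

theorem feedback_cons (s : S) (d : List α) (a : α) (u : List α) :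
    (N.next s a, d ++ [a], u ++ N.out s a) ∈ N.feedback (s, d, a :: u) := rfl

variable {N}

theorem eq_run_of_reaches {s s' : S} {d u d' u' : List α}
    (h : Reaches N.feedback (s, d, u) (s', d', u')) :
    ∃ v, d' = d ++ v ∧ s' = N.run s v ∧ v ++ u' = u ++ N.output s v := by
  generalize hc : (s, d, u) = c at h
  induction h using Relation.ReflTransGen.head_induction_on generalizing s d u with
  | refl =>
    simp only [Prod.mk.injEq] at hc
    obtain ⟨rfl, rfl, rfl⟩ := hc
    exact ⟨[], by simp, rfl, by simp [output]⟩
  | head h _ ih =>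
    subst hc
    cases u with
    | nil => simp [feedback] at h
    | cons a u =>
      simp only [feedback, Option.mem_def, Option.some.injEq] at h
      obtain ⟨v, rfl, rfl, hv⟩ := ih h
      exact ⟨a :: v, by simp, rfl, by simp [output, hv]⟩

/-- The queue has a first letter, and the equation forces it to be the next letter of `v`; so the
equation fixes the run step by step. From an empty queue, letters of `v` could satisfy the equation
by producing themselves. -/
theorem reaches_run {c : S × List α × List α}
    (hne : ∀ s d u, Reaches N.feedback c (s, d, u) → u ≠ []) (u : List α) {s : S} {d q v : List α}
    (h : Reaches N.feedback c (s, d, q)) (hv : v ++ u = q ++ N.output s v) :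
    Reaches N.feedback c (N.run s v, d ++ v, u) := by
  induction v generalizing s d q with
  | nil =>
    simp only [output, List.append_nil, List.nil_append] at hv
    subst hv
    simpa [run] using h
  | cons a v ih =>
    cases q with
    | nil => exact absurd rfl (hne _ _ _ h)
    | cons b q =>
      simp only [output, List.cons_append, List.cons.injEq] at hv
      obtain ⟨rfl, hv⟩ := hv
      have := ih (h.tail (N.feedback_cons s d a q)) (by rw [hv, List.append_assoc])
      rwa [List.append_assoc, List.singleton_append] at this

theorem reaches_iff {s s' : S} {w d u : List α}
    (hne : ∀ s' d u, Reaches N.feedback (s, [], w) (s', d, u) → u ≠ []) :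
    Reaches N.feedback (s, [], w) (s', d, u) ↔ s' = N.run s d ∧ d ++ u = w ++ N.output s d := by
  constructor
  · intro h
    obtain ⟨v, rfl, rfl, hv⟩ := eq_run_of_reaches h
    exact ⟨rfl, hv⟩
  · rintro ⟨rfl, h⟩
    exact reaches_run hne u .refl h

end SequentialTransducer

/-! ### Growing blocks after halting -/

/-- The words `w`, `w bᵍ $`, `w bᵍ $ bᵍ⁺¹ $`, … over an alphabet with an additional letter `$`. -/
def growingWord {α : Type} (b : α) (w : List (Option α)) (g : ℕ) : ℕ → List (Option α)
  | 0 => w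
  | k + 1 => growingWord b w g k ++ List.replicate (g + k) (some b) ++ [none]

namespace QueueMachine

variable {S α : Type}

/-- The transducer that works like a queue machine until that halts, and then writes words of
growing length, separated by the additional letter `none`. The state `Sum.inr true` is reached
when this letter has just been written. -/
def toTransducer (M : QueueMachine S α) (b : α) : SequentialTransducer (S ⊕ Bool) (Option α) where
  next
    | .inl s, some a => match M s a with
      | some (s', _) => .inl s'
      | none => .inr true
    | .inl _, none => .inr false
    | .inr _, a => .inr a.isNone
  out
    | .inl s, some a => match M s a with
      | some (_, o) => o.map some
      | none => [none]
    | .inl _, none => []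
    | .inr _, some _ => [some b]
    | .inr _, none => [some b, none]

variable {M : QueueMachine S α} {b : α}

theorem toTransducer_length_out_le
    (hM : ∀ {s s' : S} {a : α} {o : List α}, M s a = some (s', o) → o.length ≤ 2)
    (s : S ⊕ Bool) (a : Option α) : ((M.toTransducer b).out s a).length ≤ 2 := by
  rcases s with s | s <;> rcases a with _ | a <;> simp only [toTransducer]
  · simp
  · rcases h : M s a with _ | ⟨s', o⟩
    · simp
    · simpa using hM h
  · simp
  · simp

theorem feedback_of_step {s s' : S} {u u' : List α} (d : List (Option α))
    (h : (s', u') ∈ M.step (s, u)) :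
    ∃ d', (.inl s', d', u'.map some) ∈ (M.toTransducer b).feedback (.inl s, d, u.map some) := by
  cases u with
  | nil => simp [step] at h
  | cons a u =>
    simp only [step, Option.mem_def, Option.map_eq_some_iff] at h
    obtain ⟨⟨s', o⟩, hM, h⟩ := h
    simp only [Prod.mk.injEq] at h
    obtain ⟨rfl, rfl⟩ := h
    refine ⟨d ++ [some a], ?_⟩
    simp [SequentialTransducer.feedback, toTransducer, hM]

theorem reaches_toTransducer {c c' : S × List α} (d : List (Option α)) (h : Reaches M.step c c') :
    ∃ d', Reaches (M.toTransducer b).feedback (.inl c.1, d, c.2.map some)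
      (.inl c'.1, d', c'.2.map some) := by
  induction h with
  | refl => exact ⟨d, .refl⟩
  | tail _ h ih =>
    obtain ⟨d', h'⟩ := ih
    obtain ⟨d'', h''⟩ := feedback_of_step d' h
    exact ⟨d'', h'.tail h''⟩

/-- The configurations of the transducer after the queue machine has halted. -/
def Growing (b : α) (w : List (Option α)) (g : ℕ)
    (c : (S ⊕ Bool) × List (Option α) × List (Option α)) : Prop :=
  ∃ (k : ℕ) (d z₁ : List (Option α)) (z₂ : List α) (h : Bool),
    c = (.inr h, d ++ z₁, z₂.map some ++ none :: List.replicate z₁.length (some b)) ∧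
    z₁.length + z₂.length + 1 = g + k ∧
    d ++ z₁ ++ z₂.map some ++ [none] = growingWord b w g k ∧ (h = true → z₁ = [])

/-- In the current block, `z₁` has been read and `z₂` has not. Each letter yields one `b` and the
closing delimiter yields `b` and a delimiter, so the next block is longer by one. -/
theorem Growing.feedback {w : List (Option α)} {g : ℕ}
    {c c' : (S ⊕ Bool) × List (Option α) × List (Option α)} (hc : Growing b w g c)
    (h : c' ∈ (M.toTransducer b).feedback c) : Growing b w g c' := by
  obtain ⟨k, d, z₁, z₂, i, rfl, hlen, hw, hi⟩ := hc
  cases z₂ with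
  | nil =>
    simp only [List.map_nil, List.nil_append, SequentialTransducer.feedback, Option.mem_def,
      Option.some.injEq] at h
    subst h
    refine ⟨k + 1, d ++ z₁ ++ [none], [], List.replicate (z₁.length + 1) b, true, ?_, ?_, ?_, ?_⟩
    · simp [toTransducer, List.replicate_succ']
    · simp at hlen ⊢; omega
    · simp only [List.map_nil, List.append_nil, List.length_nil, add_zero] at hw hlen
      simp [growingWord, ← hw, ← hlen]
    · simp
  | cons a z₂ =>
    simp only [List.map_cons, List.cons_append, SequentialTransducer.feedback, Option.mem_def,
      Option.some.injEq] at h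
    subst h
    refine ⟨k, d, z₁ ++ [some a], z₂, false, ?_, ?_, ?_, ?_⟩
    · simp [toTransducer, List.replicate_succ']
    · simp at hlen ⊢; omega
    · simpa using hw
    · simp

theorem Growing.reaches {w : List (Option α)} {g : ℕ}
    {c c' : (S ⊕ Bool) × List (Option α) × List (Option α)} (hc : Growing b w g c)
    (h : Reaches (M.toTransducer b).feedback c c') : Growing b w g c' := by
  induction h with
  | refl => exact hc
  | tail _ h ih => exact ih.feedback h

theorem reaches_growing (i : Bool) (d r : List (Option α)) (z : List α) :
    ∃ j, Reaches (M.toTransducer b).feedback (.inr i, d, z.map some ++ r)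
      (.inr j, d ++ z.map some, r ++ List.replicate z.length (some b)) := by
  induction z generalizing i d r with
  | nil =>
    refine ⟨i, ?_⟩
    simp only [List.map_nil, List.nil_append, List.append_nil, List.length_nil, List.replicate_zero]
    exact .refl
  | cons a z ih =>
    obtain ⟨j, h⟩ := ih false (d ++ [some a]) (r ++ [some b])
    refine ⟨j, .head (SequentialTransducer.feedback_cons _ _ _ _ (z.map some ++ r)) ?_⟩
    rw [List.append_assoc d, List.append_assoc r] at h
    rw [List.append_assoc (z.map some)]
    exact h

theorem reaches_growing_none (i : Bool) (d : List (Option α)) (z : List α) :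
    Reaches (M.toTransducer b).feedback (.inr i, d, z.map some ++ [none])
      (.inr true, d ++ z.map some ++ [none], List.replicate (z.length + 1) (some b) ++ [none]) := by
  obtain ⟨j, h⟩ := reaches_growing (M := M) (b := b) i d [none] z
  refine h.tail ?_
  simp [SequentialTransducer.feedback, toTransducer, List.replicate_succ']

theorem exists_growingWord_of_halts {s : S} {u : List α} (h : M.Halts (s, u)) (b : α) :
    ∃ (w : List (Option α)) (g : ℕ),
      (∀ d q, Reaches (M.toTransducer b).feedback (.inl s, [], u.map some) (.inr true, d, q) →
        ∃ k, d ++ q = growingWord b w g k) ∧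
      ∀ k, ∃ d q, Reaches (M.toTransducer b).feedback (.inl s, [], u.map some) (.inr true, d, q) ∧
        d ++ q = growingWord b w g k := by
  obtain ⟨⟨s', _ | ⟨a, v⟩⟩, hr, hne, hstep⟩ := h
  · simp at hne
  have hM : M s' a = none := by simpa [step] using hstep
  obtain ⟨d₀, hD⟩ := reaches_toTransducer (b := b) [] hr
  have hC : (M.toTransducer b).feedback (.inl s', d₀, (a :: v).map some) =
      some (.inr true, d₀ ++ [some a], v.map some ++ [none]) := by
    simp [SequentialTransducer.feedback, toTransducer, hM]
  have hr₀ := hD.tail hC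
  -- The machine halts on reading `a`, with `v` left in the queue. The delimiter then written closes
  -- `v`, which serves as the block before the first counted one, of length `v.length + 1`.
  refine ⟨d₀ ++ [some a] ++ v.map some ++ [none], v.length + 1, fun d q hq => ?_, fun k => ?_⟩
  -- The states after halting are never left, so `inr true` cannot occur before the last simulated
  -- configuration.
  · have hclosed : ∀ {c c'}, Reaches (M.toTransducer b).feedback c c' → c.1.isRight →
        c'.1.isRight := by
      intro c c' h hc
      induction h with
      | refl => exact hc
      | @tail c c' _ h ih =>
        obtain ⟨s | i, d, _ | ⟨a, u⟩⟩ := c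
        · simp at ih
        · simp at ih
        · simp [SequentialTransducer.feedback] at h
        · simp only [SequentialTransducer.feedback, Option.mem_def, Option.some.injEq] at h
          subst h
          rfl
    rcases reaches_total hD hq with h | h
    · rcases h.cases_head with h | ⟨c, hc, h⟩
      · simp at h
      · rw [hC, Option.mem_def, Option.some.injEq] at hc
        subst hc
        obtain ⟨k, d', z₁, z₂, i, hc, -, hw, hi⟩ := Growing.reaches (b := b) (g := v.length + 1)
          (w := d₀ ++ [some a] ++ v.map some ++ [none])
          ⟨0, d₀ ++ [some a], [], v, true, by simp, by simp, by simp [growingWord], by simp⟩ h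
        simp only [Prod.mk.injEq, Sum.inr.injEq] at hc
        obtain ⟨rfl, rfl, rfl⟩ := hc
        obtain rfl := hi rfl
        exact ⟨k, by simpa using hw⟩
    · exact absurd (hclosed h rfl) (by simp)
  -- For the induction, the queue must be exactly one block of known length.
  · suffices ∃ (d : List (Option α)) (z : List α),
        Reaches (M.toTransducer b).feedback (.inl s, [], u.map some)
          (.inr true, d, z.map some ++ [none]) ∧ z.length + 1 = v.length + 1 + k ∧
        d ++ z.map some ++ [none] = growingWord b (d₀ ++ [some a] ++ v.map some ++ [none])
          (v.length + 1) k by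
      obtain ⟨d, z, h, -, hw⟩ := this
      exact ⟨d, _, h, by rw [← hw, List.append_assoc]⟩
    induction k with
    | zero => exact ⟨d₀ ++ [some a], v, hr₀, by simp, by simp [growingWord]⟩
    | succ k ih =>
      obtain ⟨d, z, h, hlen, hw⟩ := ih
      refine ⟨d ++ z.map some ++ [none], List.replicate (z.length + 1) b, ?_, ?_, ?_⟩
      · rw [List.map_replicate]
        exact h.trans (reaches_growing_none true d z)
      · simp; omega
      · rw [growingWord, hw, ← hlen, List.map_replicate]

/-- Gives both that the queue stays nonempty and that a state `inr` certifies halting. After halting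
a delimiter is always queued, because reading one writes another. -/
theorem reaches_toTransducer_cases {s : S} {u : List α}
    {c : (S ⊕ Bool) × List (Option α) × List (Option α)}
    (h : Reaches (M.toTransducer b).feedback (.inl s, [], u.map some) c) :
    (∃ s' v, Reaches M.step (s, u) (s', v) ∧ c.1 = .inl s' ∧ c.2.2 = v.map some) ∨
      (M.Halts (s, u) ∧ c.1.isRight ∧ none ∈ c.2.2) := by
  induction h with
  | refl => exact .inl ⟨s, u, .refl, rfl, rfl⟩
  | @tail c c' _ h ih =>
    obtain ⟨s₁, d, q⟩ := c
    rcases ih with ⟨s', v, hr, hs, hv⟩ | ⟨hh, hs, hn⟩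
    · simp only at hs hv
      subst hs hv
      cases v with
      | nil => simp [SequentialTransducer.feedback] at h
      | cons a v =>
        simp only [List.map_cons, SequentialTransducer.feedback, Option.mem_def,
          Option.some.injEq] at h
        subst h
        rcases hM : M s' a with _ | ⟨s'', o⟩
        · exact .inr ⟨⟨_, hr, by simp, by simp [step, hM]⟩, by simp [toTransducer, hM],
            by simp [toTransducer, hM]⟩
        · exact .inl ⟨s'', v ++ o, hr.tail (step_cons M v hM), by simp [toTransducer, hM],
            by simp [toTransducer, hM]⟩
    · obtain ⟨i, rfl⟩ := Sum.isRight_iff.1 hs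
      cases q with
      | nil => simp at hn
      | cons a q =>
        simp only [SequentialTransducer.feedback, Option.mem_def, Option.some.injEq] at h
        subst h
        refine .inr ⟨hh, rfl, ?_⟩
        cases a <;> simp_all [toTransducer]

theorem NeverEmpty.toTransducer {s : S} {u : List α} (h : M.NeverEmpty (s, u)) (s' : S ⊕ Bool)
    (d q : List (Option α))
    (hr : Reaches (M.toTransducer b).feedback (.inl s, [], u.map some) (s', d, q)) : q ≠ [] := by
  rintro rfl
  rcases reaches_toTransducer_cases hr with ⟨s', v, hr, -, hv⟩ | ⟨-, -, hn⟩
  · exact h _ hr (by simpa using hv.symm)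
  · simp at hn

theorem halts_of_reaches_toTransducer {s : S} {u : List α} {i : Bool} {d q : List (Option α)}
    (hr : Reaches (M.toTransducer b).feedback (.inl s, [], u.map some) (.inr i, d, q)) :
    M.Halts (s, u) := by
  rcases reaches_toTransducer_cases hr with ⟨s', v, -, hs, -⟩ | ⟨h, -, -⟩
  · simp at hs
  · exact h

end QueueMachine

/-! ### Runs and a criterion for non-rationality -/

namespace MultiTapeAutomaton

variable {T α β Q Q' : Type} [DecidableEq T]

/-- Some run from a state with given tape contents reaches an accepting state. -/
def AcceptsFrom (A : MultiTapeAutomaton T α Q) (q : Q) (y : T → List (Option α)) : Prop :=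
  ∃ q' ∈ A.accept, ∃ y', Relation.ReflTransGen A.Move (q, y) (q', y')

theorem mem_language_iff (A : MultiTapeAutomaton T α Q) (x : T → List α) :
    x ∈ A.language ↔ ∃ q ∈ A.start, A.AcceptsFrom q (marked x) := Iff.rfl

theorem acceptsFrom_of_mem {A : MultiTapeAutomaton T α Q} {q : Q} (h : q ∈ A.accept)
    (y : T → List (Option α)) : A.AcceptsFrom q y :=
  ⟨q, h, y, .refl⟩

theorem acceptsFrom_iff (A : MultiTapeAutomaton T α Q) {q : Q} (hq : q ∉ A.accept)
    (y : T → List (Option α)) :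
    A.AcceptsFrom q y ↔ ∃ s rest, y (A.tape q) = s :: rest ∧ ∃ q' ∈ A.step q s,
      A.AcceptsFrom q' (Function.update y (A.tape q) rest) := by
  constructor
  · rintro ⟨q', hq', y', h⟩
    rcases h.cases_head with h | ⟨⟨q₁, y₁⟩, ⟨s, rest, h₁, h₂, h₃⟩, h⟩
    · simp only [Prod.mk.injEq] at h
      exact absurd (h.1 ▸ hq') hq
    · simp only at h₁ h₂ h₃
      subst h₃
      exact ⟨s, rest, h₁, q₁, h₂, q', hq', y', h⟩
  · rintro ⟨s, rest, h₁, q₁, h₂, q', hq', y', h⟩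
    exact ⟨q', hq', y', .head ⟨s, rest, h₁, h₂, rfl⟩ h⟩

theorem acceptsFrom_iff_of_cons (A : MultiTapeAutomaton T α Q) {q : Q} (hq : q ∉ A.accept)
    {y : T → List (Option α)} {t : T} (ht : A.tape q = t) {s : Option α} {rest : List (Option α)}
    (hy : y t = s :: rest) :
    A.AcceptsFrom q y ↔ ∃ q' ∈ A.step q s, A.AcceptsFrom q' (Function.update y t rest) := by
  subst ht
  rw [acceptsFrom_iff A hq, hy]
  constructor
  · rintro ⟨s', rest', h, h'⟩
    simp only [List.cons.injEq] at h
    obtain ⟨rfl, rfl⟩ := h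
    exact h'
  · exact fun h => ⟨s, rest, rfl, h⟩

/-- A run consumes a prefix of every tape, and is possible whatever follows these prefixes. -/
theorem exists_consumed (A : MultiTapeAutomaton T α Q) {c c' : Config T α Q}
    (h : Relation.ReflTransGen A.Move c c') :
    ∃ r : T → List (Option α), (∀ t, c.2 t = r t ++ c'.2 t) ∧
      ∀ z : T → List (Option α),
        Relation.ReflTransGen A.Move (c.1, fun t => r t ++ z t) (c'.1, z) := by
  induction h using Relation.ReflTransGen.head_induction_on with
  | refl => exact ⟨fun _ => [], fun _ => rfl, fun _ => .refl⟩
  | @head c c₁ h _ ih =>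
    obtain ⟨s, rest, h₁, h₂, h₃⟩ := h
    obtain ⟨r, hr, hz⟩ := ih
    refine ⟨Function.update r (A.tape c.1) (s :: r (A.tape c.1)), fun t => ?_, fun z =>
      .head (b := (c₁.1, fun t => r t ++ z t))
        ⟨s, r (A.tape c.1) ++ z (A.tape c.1), ?_, h₂, ?_⟩ (hz z)⟩
    · have := hr t
      rw [h₃] at this
      rcases eq_or_ne t (A.tape c.1) with rfl | ht
      · rw [Function.update_self] at this
        rw [Function.update_self, h₁, this]
        rfl
      · rw [Function.update_of_ne ht] at this
        rw [Function.update_of_ne ht, this]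
    · simp
    · funext t
      rcases eq_or_ne t (A.tape c.1) with rfl | ht
      · simp
      · simp [Function.update_of_ne ht]

/-- A run either stops inside a prefix of a tape or passes the end of the prefix. -/
theorem exists_crossing (A : MultiTapeAutomaton T α Q) {c c' : Config T α Q}
    (h : Relation.ReflTransGen A.Move c c') (t : T) {p z : List (Option α)}
    (hp : c.2 t = p ++ z) :
    (∃ p', c'.2 t = p' ++ z) ∨
      ∃ m, Relation.ReflTransGen A.Move c m ∧ Relation.ReflTransGen A.Move m c' ∧ m.2 t = z := by
  induction h using Relation.ReflTransGen.head_induction_on generalizing p with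
  | refl =>
    cases p with
    | nil => exact .inr ⟨c', .refl, .refl, hp⟩
    | cons a p => exact .inl ⟨_, hp⟩
  | @head c c₁ h hr ih =>
    cases p with
    | nil => exact .inr ⟨c, .refl, .head h hr, hp⟩
    | cons a p =>
      have h' := h
      obtain ⟨s, rest, h₁, h₂, h₃⟩ := h
      have key : ∃ p', c₁.2 t = p' ++ z := by
        rw [h₃]
        rcases eq_or_ne t (A.tape c.1) with rfl | ht
        · rw [h₁, List.cons_append, List.cons.injEq] at hp
          exact ⟨p, by simp [hp.2]⟩
        · exact ⟨a :: p, by rw [Function.update_of_ne ht, hp]⟩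
      obtain ⟨p', hp'⟩ := key
      rcases ih hp' with h₁ | ⟨m, h₁, h₂, h₃⟩
      · exact .inl h₁
      · exact .inr ⟨m, .head h' h₁, h₂, h₃⟩

end MultiTapeAutomaton

theorem List.map_some_append_none_inj {α : Type} {u v : List α} {r r' : List (Option α)} :
    u.map some ++ none :: r = v.map some ++ none :: r' ↔ u = v ∧ r = r' := by
  induction u generalizing v with
  | nil => cases v <;> simp
  | cons a u ih => cases v <;> simp [ih, and_assoc]

/-- On a tape not read completely the end-marker is unread, so the consumed part consists of
letters. -/
theorem List.exists_of_append_eq_map_some_append_none {α : Type} {l m : List (Option α)}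
    {w : List α} (h : l ++ m = w.map some ++ [none]) (hm : m ≠ []) :
    ∃ u v : List α, l = u.map some ∧ m = v.map some ++ [none] := by
  induction l generalizing w with
  | nil => exact ⟨[], w, rfl, h⟩
  | cons a l ih =>
    cases w with
    | nil =>
      simp only [List.map_nil, List.nil_append, List.cons_append, List.cons.injEq,
        List.append_eq_nil_iff] at h
      exact absurd h.2.2 hm
    | cons b w =>
      simp only [List.map_cons, List.cons_append, List.cons.injEq] at h
      obtain ⟨u, v, rfl, rfl⟩ := ih h.2
      exact ⟨b :: u, v, by simp [h.1], rfl⟩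

open MultiTapeAutomaton in
/-- A criterion for languages that are not rational: infinitely many prefixes of the words on a
tape have a continuation that fits none of the others. -/
theorem not_isRationalLanguage_of_forall_ne {T α : Type} [DecidableEq T] [Finite T]
    {L : Set (T → List α)} (t : T) (p s : ℕ → List α)
    (hL : ∀ i, ∃ x ∈ L, x t = p i ++ s i) (hL' : ∀ x ∈ L, ∀ i j, x t = p i ++ s j → i = j) :
    ¬ IsRationalLanguage L := by
  rintro ⟨Q, _, A, rfl⟩
  choose x hx hxt using hL
  have hmt : ∀ i, marked (x i) t = (p i).map some ++ ((s i).map some ++ [none]) := by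
    intro i; simp [marked, hxt]
  have key : ∀ i, ∃ (q : Q) (y : T → List (Option α)),
      (∃ q₀ ∈ A.start, Relation.ReflTransGen A.Move (q₀, marked (x i)) (q, y)) ∧
      A.AcceptsFrom q y ∧ y t = (s i).map some ++ [none] := by
    intro i
    obtain ⟨q₀, hq₀, q, hq, y, h⟩ := hx i
    rcases A.exists_crossing h t (hmt i) with ⟨p', hp'⟩ | ⟨⟨q', y'⟩, h₁, h₂, h₃⟩
    -- The run accepts without touching the suffix, so it also accepts with `s (i + 1)` in its
    -- place.
    · exfalso
      obtain ⟨r, hr, hz⟩ := A.exists_consumed h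
      simp only at hr hz hp'
      have : Function.update (x i) t (p i ++ s (i + 1)) ∈ A.language := by
        refine ⟨q₀, hq₀, q, hq, Function.update y t (p' ++ ((s (i + 1)).map some ++ [none])), ?_⟩
        convert hz _ using 2
        funext t'
        rcases eq_or_ne t' t with rfl | ht
        · have h₁ := hr t'
          rw [hmt, hp', ← List.append_assoc (r t'), List.append_left_inj] at h₁
          simp [marked, h₁]
        · have h₁ := hr t'
          simp only [marked] at h₁
          simp [marked, Function.update_of_ne ht, h₁]
      have := hL' _ this i (i + 1) (by simp)
      omega
    · exact ⟨q', y', ⟨q₀, hq₀, h₁⟩, ⟨q, hq, y, h₂⟩, h₃⟩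
  choose q y hstart hacc hy using key
  -- The pigeonhole also records which tapes are exhausted. Otherwise the part consumed for `i` and
  -- the part unread for `j` might join to a tape with no end-marker or two.
  obtain ⟨i, j, hij, he⟩ := Finite.exists_ne_map_eq_of_infinite
    fun i => (q i, {t | y i t = []})
  simp only [Prod.mk.injEq, Set.ext_iff, Set.mem_ofPred_eq] at he
  obtain ⟨hq, he⟩ := he
  obtain ⟨q₀, hq₀, hi⟩ := hstart i
  obtain ⟨q₁, -, hj⟩ := hstart j
  obtain ⟨r, hr, hz⟩ := A.exists_consumed hi
  obtain ⟨r', hr', -⟩ := A.exists_consumed hj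
  simp only at hr hz hr'
  have hX : ∀ t, ∃ w : List α, w.map some ++ [none] = r t ++ y j t := by
    intro t
    by_cases hyt : y i t = []
    · rw [(he t).1 hyt]
      conv in r t ++ [] => rw [← hyt]
      rw [← hr]
      exact ⟨x i t, rfl⟩
    · obtain ⟨u, -, hu, -⟩ := List.exists_of_append_eq_map_some_append_none (hr t).symm hyt
      obtain ⟨-, v, -, hv⟩ :=
        List.exists_of_append_eq_map_some_append_none (hr' t).symm fun h => hyt ((he t).2 h)
      exact ⟨u ++ v, by simp [hu, hv]⟩
  choose X hX using hX
  have hXL : X ∈ A.language := by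
    refine ⟨q₀, hq₀, ?_⟩
    obtain ⟨q', hq', y', h⟩ := hacc j
    refine ⟨q', hq', y', Relation.ReflTransGen.trans ?_ h⟩
    have : marked X = fun t => r t ++ y j t := funext hX
    rw [this, ← hq]
    exact hz _
  refine hij (hL' X hXL i j ?_)
  have h₁ := hr t
  rw [hmt, hy, List.append_left_inj] at h₁
  have h₂ := hX t
  rw [← h₁, hy, ← List.append_assoc, ← List.map_append] at h₂
  exact (List.map_some_append_none_inj.1 h₂).1

theorem isRationalLanguage_empty {T α : Type} [DecidableEq T] :
    IsRationalLanguage (∅ : Set (T → List α)) :=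
  ⟨Empty, inferInstance, ⟨Empty.elim, fun q => q.elim, ∅, ∅⟩, by
    ext x; simp [MultiTapeAutomaton.language]⟩

/-! ### Renaming of letters and states -/

namespace MultiTapeAutomaton

variable {T α β Q Q' : Type} [DecidableEq T]

theorem mem_language_of_map {A : MultiTapeAutomaton T α Q} {B : MultiTapeAutomaton T β Q'}
    (f : α → β) (g : Q → Q') (htape : ∀ q, B.tape (g q) = A.tape q)
    (hstep : ∀ q s q', q' ∈ A.step q s → g q' ∈ B.step (g q) (s.map f))
    (hstart : ∀ q ∈ A.start, g q ∈ B.start) (haccept : ∀ q ∈ A.accept, g q ∈ B.accept)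
    {x : T → List α} (hx : x ∈ A.language) : (fun t => (x t).map f) ∈ B.language := by
  obtain ⟨q₀, hq₀, q, hq, y, h⟩ := hx
  refine ⟨g q₀, hstart _ hq₀, g q, haccept _ hq, fun t => (y t).map (Option.map f), ?_⟩
  have := h.lift (p := B.Move)
    (fun c : Config T α Q => (g c.1, fun t => (c.2 t).map (Option.map f))) ?_
  · convert this using 2
    funext t
    simp [marked, Function.comp_def]
  · rintro ⟨q, y⟩ ⟨q', y'⟩ ⟨s, rest, h₁, h₂, h₃⟩
    simp only at h₁ h₂ h₃
    refine ⟨s.map f, rest.map (Option.map f), by simp [htape, h₁], hstep _ _ _ h₂, ?_⟩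
    subst h₃
    funext t
    simp only [htape]
    rcases eq_or_ne t (A.tape q) with rfl | ht
    · simp
    · simp [Function.update_of_ne ht]

theorem map_mem_language_iff {A : MultiTapeAutomaton T α Q} {B : MultiTapeAutomaton T β Q'}
    (f : α ≃ β) (g : Q ≃ Q') (htape : ∀ q, B.tape (g q) = A.tape q)
    (hstep : ∀ q s q', g q' ∈ B.step (g q) (s.map f) ↔ q' ∈ A.step q s)
    (hstart : ∀ q, g q ∈ B.start ↔ q ∈ A.start) (haccept : ∀ q, g q ∈ B.accept ↔ q ∈ A.accept)
    (x : T → List α) : (fun t => (x t).map f) ∈ B.language ↔ x ∈ A.language := by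
  refine ⟨fun h => ?_, mem_language_of_map f g htape (fun q s q' => (hstep q s q').2)
    (fun q => (hstart q).2) fun q => (haccept q).2⟩
  have := mem_language_of_map (B := A) f.symm g.symm (fun q => by simp [← htape])
    (fun q s q' h => by
      rw [← hstep]
      simpa [Function.comp_def] using h)
    (fun q h => by simpa [← hstart] using h) (fun q h => by simpa [← haccept] using h) h
  simpa [Function.comp_def] using this

end MultiTapeAutomaton

theorem IsRationalLanguage.comap {T α β : Type} [DecidableEq T] {L : Set (T → List β)}
    (hL : IsRationalLanguage L) (f : α ≃ β) :
    IsRationalLanguage {x : T → List α | (fun t => (x t).map f) ∈ L} := by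
  obtain ⟨Q, hQ, A, rfl⟩ := hL
  refine ⟨Q, hQ, ⟨A.tape, fun q s => A.step q (s.map f), A.start, A.accept⟩, ?_⟩
  ext x
  exact (MultiTapeAutomaton.map_mem_language_iff f (Equiv.refl Q) (fun _ => rfl)
    (fun _ _ _ => Iff.rfl) (fun _ => Iff.rfl) (fun _ => Iff.rfl) x).symm

/-! ### The automaton for the shifted comparison -/

namespace MultiTapeAutomaton

variable {T α Q : Type} [DecidableEq T]

/-- The automaton that first reads the word `aᵐe` on a tape and then works like a given automaton
from a given state. -/
def prefixed (A : MultiTapeAutomaton T α Q) (t : T) (a e : α) (q₀ : Q) (m : ℕ) :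
    MultiTapeAutomaton T α (Q ⊕ Fin (m + 1)) where
  tape := Sum.elim A.tape fun _ => t
  step
    | .inl q, s => {p | ∃ q' ∈ A.step q s, p = .inl q'}
    | .inr i, s => {p | (s = some a ∧ ∃ j : Fin (m + 1), (j : ℕ) = i + 1 ∧ p = .inr j) ∨
        (s = some e ∧ (i : ℕ) = m ∧ p = .inl q₀)}
  start := {.inr 0}
  accept := {p | ∃ q ∈ A.accept, p = .inl q}

variable {A : MultiTapeAutomaton T α Q} {t : T} {a e : α} {q₀ : Q} {m : ℕ}

theorem prefixed_acceptsFrom_inl (q : Q) (y : T → List (Option α)) :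
    (A.prefixed t a e q₀ m).AcceptsFrom (.inl q) y ↔ A.AcceptsFrom q y := by
  constructor
  · rintro ⟨_, ⟨q', hq', rfl⟩, y', h⟩
    refine ⟨q', hq', y', ?_⟩
    generalize hc : ((.inl q, y) : Config T α (Q ⊕ Fin (m + 1))) = c at h
    induction h using Relation.ReflTransGen.head_induction_on generalizing q y with
    | refl =>
      simp only [Prod.mk.injEq, Sum.inl.injEq] at hc
      obtain ⟨rfl, rfl⟩ := hc
      exact .refl
    | head h _ ih =>
      subst hc
      rename_i c' _
      obtain ⟨p, z⟩ := c'
      obtain ⟨s, rest, h₁, ⟨q₁, h₂, rfl⟩, h₃⟩ := h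
      exact .head (b := (q₁, z)) ⟨s, rest, h₁, h₂, h₃⟩ (ih _ _ rfl)
  · rintro ⟨q', hq', y', h⟩
    refine ⟨.inl q', ⟨q', hq', rfl⟩, y', ?_⟩
    refine h.lift (p := (A.prefixed t a e q₀ m).Move)
      (fun c : Config T α Q => ((.inl c.1, c.2) : Config T α (Q ⊕ Fin (m + 1)))) ?_
    rintro c c' ⟨s, rest, h₁, h₂, h₃⟩
    exact ⟨s, rest, h₁, ⟨_, h₂, rfl⟩, h₃⟩

/-- The induction is on the number `n` of letters `a` still to be read before `e`. -/
theorem prefixed_acceptsFrom_inr (n : ℕ) (i : Fin (m + 1)) (hi : i + n = m) (v : List α)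
    (y : T → List (Option α)) (hy : y t = v.map some ++ [none]) :
    (A.prefixed t a e q₀ m).AcceptsFrom (.inr i) y ↔
      ∃ u, v = List.replicate n a ++ e :: u ∧
        A.AcceptsFrom q₀ (Function.update y t (u.map some ++ [none])) := by
  have hacc : ∀ i : Fin (m + 1), Sum.inr i ∉ (A.prefixed t a e q₀ m).accept := by
    rintro i ⟨q, -, hq⟩
    cases hq
  induction n generalizing i v y with
  | zero =>
    have : ∀ j : Fin (m + 1), (j : ℕ) ≠ i + 1 := fun j => by omega
    cases v with
    | nil =>
      rw [acceptsFrom_iff_of_cons _ (hacc i) (t := t) rfl hy]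
      simp [prefixed]
    | cons b v =>
      rw [acceptsFrom_iff_of_cons _ (hacc i) (t := t) (rest := v.map some ++ [none]) rfl hy]
      simp only [prefixed, Option.some.injEq, this, false_and, exists_false, and_false, false_or,
        Set.mem_ofPred_eq, List.replicate_zero, List.nil_append, List.cons.injEq]
      constructor
      · rintro ⟨_, ⟨rfl, -, rfl⟩, h⟩
        exact ⟨v, ⟨rfl, rfl⟩, (prefixed_acceptsFrom_inl _ _).1 h⟩
      · rintro ⟨_, ⟨rfl, rfl⟩, h⟩
        exact ⟨_, ⟨rfl, by omega, rfl⟩, (prefixed_acceptsFrom_inl _ _).2 h⟩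
  | succ n ih =>
    cases v with
    | nil =>
      rw [acceptsFrom_iff_of_cons _ (hacc i) (t := t) rfl hy]
      simp [prefixed]
    | cons b v =>
      rw [acceptsFrom_iff_of_cons _ (hacc i) (t := t) (rest := v.map some ++ [none]) rfl hy]
      have ih' := ih ⟨i + 1, by omega⟩ (by simp only; omega) v
        (Function.update y t (v.map some ++ [none])) (Function.update_self ..)
      simp only [Function.update_idem] at ih'
      constructor
      · rintro ⟨_, ⟨hb, j, hj, rfl⟩ | ⟨-, hm, -⟩, h⟩
        · have hj' : j = ⟨i + 1, by omega⟩ := Fin.ext hj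
          rw [hj'] at h
          obtain ⟨u, rfl, hu⟩ := ih'.1 h
          exact ⟨u, by simp [List.replicate_succ, Option.some.inj hb], hu⟩
        · omega
      · rintro ⟨u, hv, hu⟩
        simp only [List.replicate_succ, List.cons_append, List.cons.injEq] at hv
        exact ⟨_, .inl ⟨by rw [hv.1], _, rfl, rfl⟩, ih'.2 ⟨u, hv.2, hu⟩⟩

theorem mem_language_prefixed (x : T → List α) :
    x ∈ (A.prefixed t a e q₀ m).language ↔ ∃ u, x t = List.replicate m a ++ e :: u ∧
      A.AcceptsFrom q₀ (Function.update (marked x) t (u.map some ++ [none])) := by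
  have := prefixed_acceptsFrom_inr (A := A) (t := t) (a := a) (e := e) (q₀ := q₀) (m := m) m 0
    (by simp) (x t) (marked x) rfl
  rw [← this, mem_language_iff]
  constructor
  · rintro ⟨_, rfl, h⟩
    exact h
  · exact fun h => ⟨_, rfl, h⟩

/-- The states of the automaton that compares two tapes. -/
inductive CompareState (α : Type)
  | read : CompareState α
  | expect : Option α → CompareState α
  | done : CompareState α

instance [Finite α] : Finite (CompareState α) :=
  Finite.of_injective (β := Option (Option (Option α)))
    (fun | .read => none | .expect s => some (some s) | .done => some none)
    fun a b h => by cases a <;> cases b <;> simp_all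

/-- The automaton that accepts when two tapes have the same content. -/
def compare (α : Type) (t₀ t₁ : T) : MultiTapeAutomaton T α (CompareState α) where
  tape
    | .expect _ => t₁
    | _ => t₀
  step
    | .read, s => {.expect s}
    | .expect s, s' => {p | s' = s ∧ p = if s = none then .done else .read}
    | .done, _ => ∅
  start := {.read}
  accept := {.done}

variable {t₀ t₁ : T}

theorem compare_acceptsFrom_expect (s : Option α) (y : T → List (Option α)) :
    (compare α t₀ t₁).AcceptsFrom (.expect s) y ↔ ∃ rest, y t₁ = s :: rest ∧
      (compare α t₀ t₁).AcceptsFrom (if s = none then .done else .read)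
        (Function.update y t₁ rest) := by
  rw [acceptsFrom_iff _ (by simp [compare])]
  constructor
  · rintro ⟨s', rest, h, _, ⟨rfl, rfl⟩, h'⟩
    exact ⟨rest, h, h'⟩
  · rintro ⟨rest, h, h'⟩
    exact ⟨s, rest, h, _, ⟨rfl, rfl⟩, h'⟩

theorem compare_acceptsFrom_read (ht : t₀ ≠ t₁) (u : List α) (y : T → List (Option α))
    (hy : y t₀ = u.map some ++ [none]) :
    (compare α t₀ t₁).AcceptsFrom .read y ↔ ∃ r, y t₁ = u.map some ++ none :: r := by
  have h₀ : CompareState.read ∉ (compare α t₀ t₁).accept := by simp [compare]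
  induction u generalizing y with
  | nil =>
    rw [acceptsFrom_iff_of_cons _ h₀ (t := t₀) rfl hy]
    simp only [compare, Set.mem_singleton_iff, exists_eq_left]
    rw [← compare, compare_acceptsFrom_expect]
    simp [Function.update_of_ne ht.symm, acceptsFrom_of_mem, compare]
  | cons a u ih =>
    rw [acceptsFrom_iff_of_cons _ h₀ (t := t₀) (rest := u.map some ++ [none]) rfl hy]
    have hy' : ∀ r, Function.update (Function.update y t₀ (u.map some ++ [none])) t₁ r t₀ =
        u.map some ++ [none] := by simp [Function.update_of_ne ht]
    simp only [compare, Set.mem_singleton_iff, exists_eq_left]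
    rw [← compare, compare_acceptsFrom_expect]
    simp only [reduceCtorEq, if_false, Function.update_of_ne ht.symm]
    constructor
    · rintro ⟨rest, h, h'⟩
      obtain ⟨r, h'⟩ := (ih _ (hy' _)).1 h'
      rw [Function.update_self] at h'
      exact ⟨r, by simp [h, h']⟩
    · rintro ⟨r, h⟩
      exact ⟨u.map some ++ none :: r, h, (ih _ (hy' _)).2 ⟨r, Function.update_self ..⟩⟩

theorem mem_language_prefixed_compare (ht : t₀ ≠ t₁) (x : T → List α) :
    x ∈ ((compare α t₀ t₁).prefixed t₀ a e .read m).language ↔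
      x t₀ = List.replicate m a ++ e :: x t₁ := by
  rw [mem_language_prefixed]
  constructor
  · rintro ⟨u, hu, h⟩
    rw [compare_acceptsFrom_read ht u _ (Function.update_self ..),
      Function.update_of_ne ht.symm] at h
    obtain ⟨r, h⟩ := h
    rw [hu, (List.map_some_append_none_inj.1 h).1]
  · intro h
    refine ⟨x t₁, h, ?_⟩
    rw [compare_acceptsFrom_read ht _ _ (Function.update_self ..),
      Function.update_of_ne ht.symm]
    exact ⟨[], rfl⟩

end MultiTapeAutomaton

/-! ### The automaton for the output -/

namespace SequentialTransducer

open MultiTapeAutomaton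

variable {T α S : Type} [DecidableEq T]

/-- The automaton that accepts when the second tape contains the output of the transducer on a
prefix of the first tape, and this prefix leads to a given set of states. -/
def toAutomaton (N : SequentialTransducer S α) (K : ℕ) (t₀ t₁ : T) (s₀ : S) (F : Set S) :
    MultiTapeAutomaton T α (({l : List α // l.length ≤ K} × S) ⊕ Bool) where
  tape
    | .inl (⟨[], _⟩, _) => t₀
    | _ => t₁
  step
    | .inl (⟨[], _⟩, s), x => {p | (∃ a l, x = some a ∧ l.1 = N.out s a ∧
        p = .inl (l, N.next s a)) ∨ (s ∈ F ∧ p = .inr false)}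
    | .inl (⟨b :: l, _⟩, s), x => {p | x = some b ∧ ∃ l', l'.1 = l ∧ p = .inl (l', s)}
    | .inr false, x => {p | x = none ∧ p = .inr true}
    | .inr true, _ => ∅
  start := {.inl (⟨[], Nat.zero_le K⟩, s₀)}
  accept := {.inr true}

variable {N : SequentialTransducer S α} {K : ℕ} {t₀ t₁ : T} {s₀ : S} {F : Set S}

theorem toAutomaton_acceptsFrom_check (y : T → List (Option α)) :
    (N.toAutomaton K t₀ t₁ s₀ F).AcceptsFrom (.inr false) y ↔ ∃ r, y t₁ = none :: r := by
  rw [acceptsFrom_iff _ (by simp [toAutomaton])]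
  constructor
  · rintro ⟨s', rest, h, _, ⟨rfl, rfl⟩, -⟩
    exact ⟨rest, h⟩
  · rintro ⟨rest, h⟩
    exact ⟨_, rest, h, _, ⟨rfl, rfl⟩, acceptsFrom_of_mem rfl _⟩

theorem toAutomaton_acceptsFrom_pending (l : List α) (hl : l.length ≤ K) (s : S)
    (y : T → List (Option α)) :
    (N.toAutomaton K t₀ t₁ s₀ F).AcceptsFrom (.inl (⟨l, hl⟩, s)) y ↔
      ∃ r, y t₁ = l.map some ++ r ∧ (N.toAutomaton K t₀ t₁ s₀ F).AcceptsFrom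
        (.inl (⟨[], Nat.zero_le K⟩, s)) (Function.update y t₁ r) := by
  induction l generalizing y with
  | nil => simp
  | cons b l ih =>
    rw [acceptsFrom_iff _ (by simp [toAutomaton])]
    constructor
    · rintro ⟨s', rest, h, _, ⟨rfl, ⟨_, hl'⟩, rfl, rfl⟩, h'⟩
      obtain ⟨r, hr, h'⟩ := (ih _ _).1 h'
      replace h : y t₁ = some b :: rest := h
      replace hr : Function.update y t₁ rest t₁ = _ := hr
      rw [Function.update_self] at hr
      replace h' : AcceptsFrom _ _ (Function.update (Function.update y t₁ rest) t₁ r) := h'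
      rw [Function.update_idem] at h'
      exact ⟨r, by simp [h, hr], h'⟩
    · rintro ⟨r, h, h'⟩
      refine ⟨some b, l.map some ++ r, h, .inl (⟨l, by simp at hl; omega⟩, s),
        ⟨rfl, _, rfl, rfl⟩, ?_⟩
      rw [ih]
      refine ⟨r, Function.update_self .., ?_⟩
      change AcceptsFrom _ _ (Function.update (Function.update y t₁ _) t₁ r)
      rwa [Function.update_idem]

/-- The end of `d` is guessed: in a state of `F`, the automaton may spend one more symbol of `t₀`,
available thanks to the end-marker, and then test whether `t₁` is at its end-marker. -/
theorem toAutomaton_acceptsFrom (ht : t₀ ≠ t₁) (hK : ∀ s a, (N.out s a).length ≤ K) (v : List α)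
    (s : S) (y : T → List (Option α)) (hy : y t₀ = v.map some ++ [none]) :
    (N.toAutomaton K t₀ t₁ s₀ F).AcceptsFrom (.inl (⟨[], Nat.zero_le K⟩, s)) y ↔
      ∃ d e r, v = d ++ e ∧ N.run s d ∈ F ∧ y t₁ = (N.output s d).map some ++ none :: r := by
  have hacc : .inl (⟨[], Nat.zero_le K⟩, s) ∉ (N.toAutomaton K t₀ t₁ s₀ F).accept := by
    simp [toAutomaton]
  induction v generalizing s y with
  | nil =>
    rw [acceptsFrom_iff_of_cons _ hacc (t := t₀) rfl hy]
    constructor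
    · rintro ⟨_, ⟨a, l, h, -⟩ | ⟨hs, rfl⟩, h⟩
      · cases h
      · rw [toAutomaton_acceptsFrom_check, Function.update_of_ne ht.symm] at h
        obtain ⟨r, h⟩ := h
        exact ⟨[], [], r, rfl, hs, h⟩
    · rintro ⟨d, e, r, h, hs, hr⟩
      obtain ⟨rfl, rfl⟩ := List.append_eq_nil_iff.1 h.symm
      refine ⟨.inr false, .inr ⟨hs, rfl⟩, ?_⟩
      rw [toAutomaton_acceptsFrom_check, Function.update_of_ne ht.symm]
      exact ⟨r, hr⟩
  | cons a v ih =>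
    rw [acceptsFrom_iff_of_cons _ hacc (t := t₀) (rest := v.map some ++ [none]) rfl hy]
    have hy' : ∀ r, Function.update (Function.update y t₀ (v.map some ++ [none])) t₁ r t₀ =
        v.map some ++ [none] := by simp [Function.update_of_ne ht]
    constructor
    · rintro ⟨_, ⟨a', l, h, hl, rfl⟩ | ⟨hs, rfl⟩, h'⟩
      · obtain rfl : a = a' := by simpa using h
        obtain ⟨l, hlK⟩ := l
        simp only at hl
        subst hl
        rw [toAutomaton_acceptsFrom_pending, Function.update_of_ne ht.symm] at h'
        obtain ⟨r', hr', h'⟩ := h'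
        obtain ⟨d, e, r, rfl, hd, h'⟩ := (ih _ _ (hy' _) (by simp [toAutomaton])).1 h'
        rw [Function.update_self] at h'
        exact ⟨a :: d, e, r, rfl, hd, by simp [hr', h', output]⟩
      · rw [toAutomaton_acceptsFrom_check, Function.update_of_ne ht.symm] at h'
        obtain ⟨r, h⟩ := h'
        exact ⟨[], a :: v, r, rfl, hs, h⟩
    · rintro ⟨_ | ⟨a', d⟩, e, r, h, hs, hr⟩
      · refine ⟨.inr false, .inr ⟨hs, rfl⟩, ?_⟩
        rw [toAutomaton_acceptsFrom_check, Function.update_of_ne ht.symm]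
        exact ⟨r, hr⟩
      · simp only [List.cons_append, List.cons.injEq] at h
        obtain ⟨rfl, rfl⟩ := h
        refine ⟨.inl (⟨N.out s a, hK s a⟩, N.next s a), .inl ⟨a, _, rfl, rfl, rfl⟩, ?_⟩
        rw [toAutomaton_acceptsFrom_pending, Function.update_of_ne ht.symm]
        exact ⟨(N.output (N.next s a) d).map some ++ none :: r, by simp [hr, output],
          (ih _ _ (hy' _) (by simp [toAutomaton])).2 ⟨d, e, r, rfl, hs, Function.update_self ..⟩⟩

theorem mem_language_toAutomaton (ht : t₀ ≠ t₁) (hK : ∀ s a, (N.out s a).length ≤ K)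
    (x : T → List α) :
    x ∈ (N.toAutomaton K t₀ t₁ s₀ F).language ↔
      ∃ d e, x t₀ = d ++ e ∧ N.run s₀ d ∈ F ∧ x t₁ = N.output s₀ d := by
  rw [mem_language_iff]
  have := toAutomaton_acceptsFrom (s₀ := s₀) (F := F) ht hK (x t₀) s₀ (marked x) rfl
  constructor
  · rintro ⟨_, rfl, h⟩
    obtain ⟨d, e, r, h₁, h₂, h₃⟩ := this.1 h
    exact ⟨d, e, h₁, h₂, (List.map_some_append_none_inj.1 h₃).1⟩
  · rintro ⟨d, e, h₁, h₂, h₃⟩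
    exact ⟨_, rfl, this.2 ⟨d, e, [], h₁, h₂, by rw [← h₃]; rfl⟩⟩

end SequentialTransducer

/-! ### Transition tables -/

namespace MultiTapeAutomaton

variable {n k : ℕ} {α Q : Type}

/-- The transitions of an automaton, with states and letters replaced by numbers. -/
def numberedTransitions {T : Type} [DecidableEq T] (A : MultiTapeAutomaton T α Q) {N : ℕ}
    (f : α ≃ Fin (k + 1)) (g : Q ≃ Fin N) : Set (ℕ × Option ℕ × ℕ) :=
  {z | ∃ q s q', q' ∈ A.step q s ∧
    z = ((g q : ℕ), (s.map f).map Fin.val, (g q' : ℕ))}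

theorem finite_numberedTransitions {T : Type} [DecidableEq T] (A : MultiTapeAutomaton T α Q) {N : ℕ}
    (f : α ≃ Fin (k + 1)) (g : Q ≃ Fin N) : (A.numberedTransitions f g).Finite := by
  have : Finite Q := Finite.of_equiv _ g.symm
  have : Finite α := Finite.of_equiv _ f.symm
  refine (Set.finite_range fun z : Q × Option α × Q =>
    (((g z.1 : ℕ), (z.2.1.map f).map Fin.val, (g z.2.2 : ℕ)) : ℕ × Option ℕ × ℕ)).subset ?_
  rintro _ ⟨q, s, q', -, rfl⟩
  exact ⟨(q, s, q'), rfl⟩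

theorem mem_numberedTransitions_iff {T : Type} [DecidableEq T] (A : MultiTapeAutomaton T α Q)
    {N : ℕ} (f : α ≃ Fin (k + 1)) (g : Q ≃ Fin N) (q q' : Q) (s : Option α) :
    ((g q : ℕ), (s.map f).map Fin.val, (g q' : ℕ)) ∈ A.numberedTransitions f g ↔
      q' ∈ A.step q s := by
  constructor
  · rintro ⟨p, r, p', h, he⟩
    simp only [Prod.mk.injEq, Fin.val_inj, g.apply_eq_iff_eq] at he
    obtain ⟨rfl, hs, rfl⟩ := he
    rwa [Option.map_injective f.injective (Option.map_injective Fin.val_injective hs)]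
  · exact fun h => ⟨q, s, q', h, rfl⟩

theorem exists_table [Finite Q] (A : MultiTapeAutomaton (Fin (n + 1)) α Q) (f : α ≃ Fin (k + 1)) :
    ∃ d : AutomatonTable, ∀ x : Fin (n + 1) → List α,
      (fun t => (x t).map f) ∈ (d.toAutomaton n k).language ↔ x ∈ A.language := by
  classical
  obtain ⟨N, ⟨g⟩⟩ := Finite.exists_equiv_fin Q
  refine ⟨⟨N, List.ofFn fun i => (A.tape (g.symm i) : ℕ),
    (Set.toFinite ((fun q => (g q : ℕ)) '' A.start)).toFinset.toList,
    (Set.toFinite ((fun q => (g q : ℕ)) '' A.accept)).toFinset.toList,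
    (A.finite_numberedTransitions f g).toFinset.toList⟩, fun x => ?_⟩
  refine map_mem_language_iff f g (fun q => ?_) (fun q s q' => ?_) (fun q => ?_) (fun q => ?_) x
  · simp [AutomatonTable.toAutomaton, List.getD_eq_getElem?_getD]
  · simpa [AutomatonTable.toAutomaton] using A.mem_numberedTransitions_iff f g q q' s
  · simp [AutomatonTable.toAutomaton, Fin.val_inj]
  · simp [AutomatonTable.toAutomaton, Fin.val_inj]

/-- The table of `A` is a constant; only the number of states and the chain of transitions reading
`aᵐe` depend on `m`. -/
theorem exists_computable_table_prefixed [Finite Q] (A : MultiTapeAutomaton (Fin (n + 1)) α Q)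
    (a e : α) (q₀ : Q) (f : α ≃ Fin (k + 1)) :
    ∃ d : ℕ → AutomatonTable, Computable d ∧ ∀ m (x : Fin (n + 1) → List α),
      (fun t => (x t).map f) ∈ ((d m).toAutomaton n k).language ↔
        x ∈ (A.prefixed 0 a e q₀ m).language := by
  classical
  obtain ⟨N, ⟨g⟩⟩ := Finite.exists_equiv_fin Q
  let tapes : List ℕ := List.ofFn fun i => (A.tape (g.symm i) : ℕ)
  let accept : List ℕ := (Set.toFinite ((fun q => (g q : ℕ)) '' A.accept)).toFinset.toList
  let transitions := (A.finite_numberedTransitions f g).toFinset.toList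
  -- The states `N, …, N + m` that read the prefix have no entry in `tapes`, so the default makes
  -- them read tape `0`, as required.
  refine ⟨fun m => AutomatonTable.equivProd.symm (N + (m + 1), tapes, [N], accept,
    (N + m, some (f e : ℕ), (g q₀ : ℕ)) ::
      (transitions ++ (List.range m).map fun i => (N + i, some (f a : ℕ), N + (i + 1)))),
    ?_, fun m x => ?_⟩
  · refine Primrec.to_comp ?_
    refine (Primrec.of_equiv_symm (e := AutomatonTable.equivProd)).comp ?_
    refine (Primrec.nat_add.comp (.const N) .succ).pair ((Primrec.const _).pair
      ((Primrec.const _).pair ((Primrec.const _).pair (Primrec.list_cons.comp ?_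
        (Primrec.list_append.comp (.const _) (Primrec.list_map .list_range ?_))))))
    · exact (Primrec.nat_add.comp (.const N) .id).pair (.const _)
    · exact ((Primrec.nat_add.comp (.const N) .snd).pair ((Primrec.const _).pair
        (Primrec.nat_add.comp (.const N) (Primrec.succ.comp .snd)))).to₂
  · have hlt : ∀ q, (g q : ℕ) < N := fun q => (g q).isLt
    have htr : ∀ z ∈ transitions, z.1 < N ∧ z.2.2 < N := by
      intro z hz
      simp only [transitions, Finset.mem_toList, Set.Finite.mem_toFinset] at hz
      obtain ⟨q, s, q', -, rfl⟩ := hz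
      exact ⟨hlt _, hlt _⟩
    refine map_mem_language_iff f ((Equiv.sumCongr g (Equiv.refl _)).trans finSumFinEquiv)
      (fun q => ?_) (fun q s q' => ?_) (fun q => ?_) (fun q => ?_) x
    · rcases q with q | i
      · simp [AutomatonTable.toAutomaton, AutomatonTable.equivProd, tapes, prefixed]
      · simp [AutomatonTable.toAutomaton, AutomatonTable.equivProd, tapes, prefixed]
    · have hs : ∀ b : α, (s.map f).map Fin.val = some (f b : ℕ) ↔ s = some b := by
        intro b
        cases s <;> simp [Fin.val_inj]
      simp only [AutomatonTable.toAutomaton, AutomatonTable.equivProd, Set.mem_ofPred_eq,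
        Equiv.coe_fn_symm_mk, List.mem_cons, List.mem_append, List.mem_map, List.mem_range,
        Prod.mk.injEq]
      rcases q with q | i <;> rcases q' with q' | j
      · have h₁ := A.mem_numberedTransitions_iff f g q q' s
        have := hlt q
        have h₂ : ∀ i, N + i ≠ g q := fun i => by omega
        have h₃ : (g q : ℕ) ≠ N + m := by omega
        simp [prefixed, transitions, h₂, h₃, ← h₁]
      · have := hlt q
        have h₂ : ∀ i, N + i ≠ g q := fun i => by omega
        have h₃ : (g q : ℕ) ≠ N + m := by omega
        have h₄ : ((g q : ℕ), (s.map f).map Fin.val, N + (j : ℕ)) ∉ transitions := fun h => by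
          have := (htr _ h).2
          simp at this
        simpa [prefixed, h₂, h₃] using h₄
      · have := hlt q'
        have h₂ : ∀ i, N + i ≠ g q' := fun i => by omega
        have h₄ : (N + (i : ℕ), (s.map f).map Fin.val, (g q' : ℕ)) ∉ transitions := fun h => by
          have := (htr _ h).1
          simp at this
        simp only [Equiv.trans_apply, Equiv.sumCongr_apply, Sum.map_inl, Sum.map_inr,
          Equiv.refl_apply, finSumFinEquiv_apply_left, finSumFinEquiv_apply_right,
          Fin.val_castAdd, Fin.val_natAdd, h₄, hs, h₂, and_false, exists_false, or_false,
          Fin.val_inj, g.apply_eq_iff_eq, prefixed, Set.mem_ofPred_eq, reduceCtorEq, false_or,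
          Sum.inl.injEq, Nat.add_left_cancel_iff]
        tauto
      · have := hlt q₀
        have h₂ : ∀ i, N + i ≠ g q₀ := fun i => by omega
        have h₄ : (N + (i : ℕ), (s.map f).map Fin.val, N + (j : ℕ)) ∉ transitions := fun h => by
          have := (htr _ h).1
          simp at this
        simp only [Equiv.trans_apply, Equiv.sumCongr_apply, Sum.map_inr,
          Equiv.refl_apply, finSumFinEquiv_apply_right, Fin.val_natAdd, h₄, hs, h₂, and_false,
          false_or, prefixed, Set.mem_ofPred_eq, reduceCtorEq, or_false, Sum.inr.injEq,
          Nat.add_left_cancel_iff]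
        constructor
        · rintro ⟨b, hb, rfl, h, hj⟩
          exact ⟨(hs a).1 h.symm, j, hj.symm, rfl⟩
        · rintro ⟨h, j', hj, rfl⟩
          exact ⟨i, by omega, rfl, ((hs a).2 h).symm, hj.symm⟩
    · rcases q with q | i
      · have : (g q : ℕ) ≠ N := (hlt q).ne
        simpa [AutomatonTable.toAutomaton, AutomatonTable.equivProd, prefixed] using this
      · simp [AutomatonTable.toAutomaton, AutomatonTable.equivProd, prefixed]
    · rcases q with q | i
      · simp [AutomatonTable.toAutomaton, AutomatonTable.equivProd, prefixed, accept, Fin.val_inj]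
      · refine iff_of_false (fun h => ?_) (fun ⟨q, _, h⟩ => by cases h)
        have h' : N + (i : ℕ) ∈ accept := h
        simp only [accept, Finset.mem_toList, Set.Finite.mem_toFinset] at h'
        obtain ⟨q, -, hq⟩ := h'
        have := hlt q
        simp only at hq
        omega

end MultiTapeAutomaton

/-! ### The reduction -/

open MultiTapeAutomaton StateTransition

theorem count_none_growingWord {α : Type} (b : α) (w : List (Option α)) (g k : ℕ) :
    (growingWord b w g k).countP Option.isNone = w.countP Option.isNone + k := by
  induction k with
  | zero => rfl
  | succ k ih =>
    rw [growingWord, List.countP_append, List.countP_append, ih]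
    simp [List.countP_replicate, add_assoc]

/-- Each prefix is continued by its next block. The number of delimiters determines the index of the
whole word, and then the length determines the last block. -/
theorem not_isRationalLanguage_of_growingWord {T α : Type} [DecidableEq T] [Finite T]
    {L : Set (T → List (Option α))} (t : T) (b : α) (w : List (Option α)) (g : ℕ)
    (hL : ∀ k, ∃ x ∈ L, x t = growingWord b w g k)
    (hL' : ∀ x ∈ L, ∃ k, x t = growingWord b w g k) : ¬ IsRationalLanguage L := by
  refine not_isRationalLanguage_of_forall_ne t (growingWord b w g)
    (fun j => List.replicate (g + j) (some b) ++ [none]) (fun i => ?_) fun x hx i j h => ?_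
  · rw [← List.append_assoc]
    exact hL (i + 1)
  · obtain ⟨k, hk⟩ := hL' x hx
    rw [hk] at h
    have hc := congrArg (List.countP Option.isNone) h
    simp only [List.countP_append, count_none_growingWord, List.countP_replicate] at hc
    obtain rfl : k = i + 1 := by simp at hc; omega
    rw [growingWord, List.append_assoc, List.append_cancel_left_eq] at h
    have := congrArg List.length h
    simpa using this

namespace QueueMachine

variable {T S α : Type} [DecidableEq T] {M : QueueMachine S α} {t₀ t₁ : T} {s : S} {a b e : α}
  {m : ℕ}

theorem mem_language_inter_iff (ht : t₀ ≠ t₁)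
    (hM : ∀ {s s' : S} {a : α} {o : List α}, M s a = some (s', o) → o.length ≤ 2)
    (hne : M.NeverEmpty (s, List.replicate m a ++ [e])) (x : T → List (Option α)) :
    x ∈ ((compare (Option α) t₀ t₁).prefixed t₀ (some a) (some e) .read m).language ∩
        ((M.toTransducer b).toAutomaton 2 t₀ t₁ (.inl s) {.inr true}).language ↔
      x t₀ = (List.replicate m a ++ [e]).map some ++ x t₁ ∧
      ∃ d q, x t₀ = d ++ q ∧ Reaches (M.toTransducer b).feedback
        (.inl s, [], (List.replicate m a ++ [e]).map some) (.inr true, d, q) := by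
  rw [Set.mem_inter_iff, mem_language_prefixed_compare ht,
    SequentialTransducer.mem_language_toAutomaton ht (toTransducer_length_out_le hM)]
  simp only [SequentialTransducer.reaches_iff hne.toTransducer, Set.mem_singleton_iff]
  have hw : (List.replicate m a ++ [e]).map some ++ x t₁ =
      List.replicate m (some a) ++ some e :: x t₁ := by simp
  rw [hw]
  refine and_congr_right fun hx => ?_
  constructor
  · rintro ⟨d, q, h₁, h₂, h₃⟩
    refine ⟨d, q, h₁, h₂.symm, ?_⟩
    rw [← h₁, hx, ← h₃, hw]
  · rintro ⟨d, q, h₁, h₂, h₃⟩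
    refine ⟨d, q, h₁, h₂.symm, ?_⟩
    rw [← h₁, hx, ← hw, List.append_cancel_left_eq] at h₃
    exact h₃

theorem isRationalLanguage_inter_iff [Finite T] (ht : t₀ ≠ t₁)
    (hM : ∀ {s s' : S} {a : α} {o : List α}, M s a = some (s', o) → o.length ≤ 2)
    (hne : M.NeverEmpty (s, List.replicate m a ++ [e])) :
    IsRationalLanguage
      (((compare (Option α) t₀ t₁).prefixed t₀ (some a) (some e) .read m).language ∩
        ((M.toTransducer b).toAutomaton 2 t₀ t₁ (.inl s) {.inr true}).language) ↔
      ¬ M.Halts (s, List.replicate m a ++ [e]) := by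
  constructor
  · intro h hh
    obtain ⟨w, g, h₁, h₂⟩ := exists_growingWord_of_halts hh b
    refine not_isRationalLanguage_of_growingWord t₀ b w g (fun k => ?_) (fun x hx => ?_) h
    · obtain ⟨d, q, hr, hk⟩ := h₂ k
      have hv := ((SequentialTransducer.reaches_iff hne.toTransducer).1 hr).2
      -- All tapes but `t₀` receive the output; this matters only on `t₁`, as the automata ignore
      -- the others.
      refine ⟨Function.update (fun _ => (M.toTransducer b).output (.inl s) d) t₀ (d ++ q),
        (mem_language_inter_iff ht hM hne _).2 ⟨?_, d, q, ?_, hr⟩, ?_⟩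
      · rw [Function.update_self, Function.update_of_ne ht.symm, hv]
      · rw [Function.update_self]
      · rw [Function.update_self, hk]
    · obtain ⟨-, d, q, hx, hr⟩ := (mem_language_inter_iff ht hM hne _).1 hx
      rw [hx]
      exact h₁ d q hr
  · intro hh
    have h : ((compare (Option α) t₀ t₁).prefixed t₀ (some a) (some e) .read m).language ∩
        ((M.toTransducer b).toAutomaton 2 t₀ t₁ (.inl s) {.inr true}).language = ∅ := by
      refine Set.eq_empty_of_forall_notMem fun x hx => hh ?_
      obtain ⟨-, d, q, -, hr⟩ := (mem_language_inter_iff ht hM hne _).1 hx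
      exact halts_of_reaches_toTransducer hr
    rw [h]
    exact isRationalLanguage_empty

end QueueMachine

theorem isRationalLanguage_comap_iff {T α β : Type} [DecidableEq T] {L : Set (T → List β)}
    (f : α ≃ β) :
    IsRationalLanguage {x : T → List α | (fun t => (x t).map f) ∈ L} ↔ IsRationalLanguage L := by
  refine ⟨fun h => ?_, fun h => h.comap f⟩
  convert h.comap f.symm using 1
  ext x
  simp [Function.comp_def]

theorem REPred.comp_computable {α β : Type*} [Primcodable α] [Primcodable β] {p : β → Prop}
    (hp : REPred p) {f : α → β} (hf : Computable f) : REPred fun a => p (f a) :=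
  Partrec.comp hp hf

/-- Every recursively enumerable predicate reduces to the complement of the rational intersection
problem for automata with at least two tapes. -/
theorem REPred.exists_reduction {p : ℕ → Prop} (hp : REPred p) (n : ℕ) (hn : 2 ≤ n + 1) :
    ∃ i : ℕ → ℕ × AutomatonTable × AutomatonTable, Computable i ∧
      ∀ m, RationalIntersectionProblemFor n (i m) ↔ ¬ p m := by
  obtain ⟨S, α, _, _, M, s, a, e, hM, hne, h⟩ := hp.exists_queueMachine
  have ht : (0 : Fin (n + 1)) ≠ 1 := by
    obtain ⟨n, rfl⟩ : ∃ l, n = l + 1 := ⟨n - 1, by omega⟩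
    exact Fin.zero_ne_one
  obtain ⟨k, ⟨f₀⟩⟩ := Finite.exists_equiv_fin α
  -- The additional letter is the delimiter, an ordinary input letter distinct from the end-marker.
  let f : Option α ≃ Fin (k + 1) := f₀.optionCongr.trans (finSuccEquiv k).symm
  have : Finite {l : List (Option α) // l.length ≤ 2} := List.finite_length_le _ 2
  obtain ⟨A, hA, hA'⟩ := exists_computable_table_prefixed
    (compare (Option α) (0 : Fin (n + 1)) 1) (some a) (some e) .read f
  obtain ⟨B, hB⟩ := exists_table
    ((M.toTransducer a).toAutomaton 2 (0 : Fin (n + 1)) 1 (.inl s) {.inr true}) f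
  refine ⟨fun m => (k, A m, B), (Computable.const k).pair (hA.pair (.const B)), fun m => ?_⟩
  rw [← h, ← QueueMachine.isRationalLanguage_inter_iff (b := a) ht hM (hne m)]
  change IsRationalLanguage _ ↔ _
  rw [← isRationalLanguage_comap_iff f]
  simp only [Set.mem_inter_iff, hA', hB]
  rfl

theorem exists_rePred_not_rePred_compl :
    ∃ p : ℕ → Prop, REPred p ∧ ¬ REPred fun m => ¬ p m := by
  refine ⟨fun m => (Nat.Partrec.Code.eval (Denumerable.ofNat Nat.Partrec.Code m) 0).Dom,
    (ComputablePred.halting_problem_re 0).comp_computable (Computable.ofNat _), fun h =>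
    ComputablePred.halting_problem_not_re 0 ((h.comp_computable Computable.encode).of_eq
      fun c => ?_)⟩
  exact iff_of_eq (congrArg (fun c => ¬ (Nat.Partrec.Code.eval c 0).Dom)
    (Denumerable.ofNat_encode c))

theorem theorem1 :
    ¬ REPred RationalIntersectionProblem ∧
    ∀ n : ℕ, 2 ≤ n + 1 → ¬ REPred (RationalIntersectionProblemFor n) := by
  have key : ∀ n : ℕ, 2 ≤ n + 1 → ¬ REPred (RationalIntersectionProblemFor n) := by
    intro n hn h
    obtain ⟨p, hp, hp'⟩ := exists_rePred_not_rePred_compl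
    obtain ⟨i, hi, hi'⟩ := hp.exists_reduction n hn
    exact hp' ((h.comp_computable hi).of_eq hi')
  -- The value `1` stands for two tapes.
  refine ⟨fun h => key 1 le_rfl ?_, key⟩
  exact h.comp_computable (f := fun i : ℕ × AutomatonTable × AutomatonTable => (1, i))
    ((Computable.const 1).pair Computable.id)
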